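/- **Theorem 5.4.** Let $\Gamma$ be an infinite discrete amenable group (not necessarily countable) and let $f=\sum_\gamma f_\gamma\gamma\in\mathbb{Z}\Gamma$. Let $\mathcal{L}\Gamma$ be the left group von Neumann algebra of $\Gamma$, i.e. the algebra of bounded operators on $\ell^2(\Gamma)$ commuting with the right translations; $\mathbb{Z}\Gamma$ is regarded as a subset of $\mathcal{L}\Gamma$ through left multiplication $(fg)_{\gamma'}=\sum_{\gamma}f_\gamma g_{\gamma^{-1}\gamma'}$. Assume that $f$ is positive in $\mathcal{L}\Gamma$ (that is, $f=b^*b$ for some $b\in\mathcal{L}\Gamma$) and invertible in $\mathcal{L}\Gamma$. Let $\{F_n\}_{n\in J}$ be a left Følner net of $\Gamma$: a net of nonempty finite subsets of $\Gamma$ with $\lim_{n}|KF_n\,\Delta\,F_n|/|F_n|=0$ for every nonempty finite $K\subseteq\Gamma$. Then for every $\varepsilon$ with $0<\varepsilon\le 1/(2\|f\|_1)$, where $\|f\|_1=\sum_\gamma|f_\gamma|$, all limits below exist and $$h(\alpha_f)=\lim_{n}\frac{1}{|F_n|}\log s_{F_n,\infty}(\varepsilon)=\lim_{n}\frac{1}{|F_n|}\log\big|\mathbb{Z}[F_n]/f_{F_n}\mathbb{Z}[F_n]\big|=\lim_{n}\frac{1}{|F_n|}\log|\det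 f_{F_n}|=\log\det\nolimits_{\mathcal{L}\Gamma}f .$$ Here: * $X_f=\{h\in(\mathbb{R}/\mathbb{Z})^\Gamma:\ \sum_{\gamma}f_\gamma h_{\gamma^{-1}\gamma'}=0\ \text{for all }\gamma'\in\Gamma\}$, a compact group which is identified with the Pontryagin dual of $\mathbb{Z}\Gamma/\mathbb{Z}\Gamma f$, and $\alpha_f$ is the action of $\Gamma$ on $X_f$ by $(\gamma h)_{\gamma'}=h_{\gamma'\gamma}$. * $h(\alpha_f)$ is the topological entropy of $\alpha_f$: the supremum over finite open covers $\mathcal U$ of $X_f$ of the limit of $\frac{1}{|F|}\log N\big(\bigvee_{\gamma\in F}\gamma^{-1}\mathcal U\big)$ as the nonempty finite set $F\subseteq\Gamma$ becomes more and more left invariant, where $N(\mathcal V)$ is the minimal number of elements of the cover $\mathcal V$ needed to cover $X_f$. * $s_{F,\infty}(\varepsilon)$ is the maximal cardinality of a set $E\subseteq X_f$ such that $\max_{\gamma\in F}\vartheta\big((\gamma x)_{e},(\gamma y)_{e}\big)>\varepsilon$ for all distinct $x,y\in E$, where $e$ is the identity of $\Gamma$ and $\vartheta(t+\mathbb{Z},t'+\mathbb{Z})=\min_{m\in\mathbb{Z}}|t-t'-m|$.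 * For a nonempty finite $F\subseteq\Gamma$, $f_F=p_F\circ f\circ\iota_F$ is the compression of left multiplication by $f$ to $\mathbb{C}[F]$ ($\iota_F$ the inclusion of the functions supported in $F$, $p_F$ the restriction to $F$); it maps $\mathbb{Z}[F]$ to itself. * $\det_{\mathcal{L}\Gamma}f=\exp\big(\tfrac12\operatorname{tr}\log(f^*f)\big)$ is the Fuglede–Kadison determinant for the canonical trace $\operatorname{tr}(a)=\langle a\,\delta_e,\delta_e\rangle$, where $\delta_e\in\ell^2(\Gamma)$ is the indicator function of $\{e\}$. -/

import Mathlib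

open Filter Topology
open scoped ENNReal Pointwise symmDiff

noncomputable section

/-! ## Invariance of finite subsets of a group and Følner nets -/

open scoped Classical in
/-- `|KF Δ F| / |F|`. -/
def invarianceDefect {Γ : Type*} [Group Γ] (K F : Finset Γ) : ℝ :=
  (((K * F) ∆ F).card : ℝ) / (F.card : ℝ)

/-- A (left) Følner net: nonempty finite sets `F n` with `|K F_n Δ F_n| / |F_n| → 0` for every
nonempty finite `K`. -/
structure IsFolnerNet {Γ : Type*} [Group Γ] {J : Type*} [Preorder J] (F : J → Finset Γ) :
    Prop where
  nonempty : ∀ n, (F n).Nonempty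
  tendsto : ∀ K : Finset Γ, K.Nonempty →
    Tendsto (fun n => invarianceDefect K (F n)) atTop (𝓝 0)

/-- The filter on finite subsets of `Γ` describing "`F` becomes more and more (left) invariant":
it is generated by the sets of nonempty finite `F` with `|KF Δ F| ≤ δ |F|`, for `K` nonempty
finite and `δ > 0`. -/
def invarianceFilter (Γ : Type*) [Group Γ] : Filter (Finset Γ) :=
  ⨅ (K : Finset Γ) (_ : K.Nonempty) (δ : ℝ) (_ : 0 < δ),
    𝓟 {F : Finset Γ | F.Nonempty ∧ invarianceDefect K F ≤ δ}

/-! ## Topological entropy -/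

/-- The minimal number of elements of the cover `U` needed to cover `X`. -/
def coverNumber {X : Type*} (U : Set (Set X)) : ℕ∞ :=
  ⨅ (W : Set (Set X)) (_ : W ⊆ U ∧ ⋃₀ W = Set.univ), W.encard

/-- The common refinement `U^F` of the covers `γ⁻¹ U`, `γ ∈ F`. -/
def coverJoin {Γ X : Type*} [Group Γ] [TopologicalSpace X] (α : Γ →* (X ≃ₜ X))
    (U : Set (Set X)) (F : Finset Γ) : Set (Set X) :=
  {V | ∃ u : Γ → Set X, (∀ γ ∈ F, u γ ∈ U) ∧ V = ⋂ γ ∈ F, (α γ) ⁻¹' (u γ)}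

/-- The entropy of the action `α` with respect to the cover `U`: the limit of
`(1/|F|) log N(U^F)` as `F` becomes more and more invariant. (This limit exists for finite open
covers when `Γ` is amenable, by the Ornstein–Weiss lemma; so it equals the upper limit.) -/
def coverEntropy {Γ X : Type*} [Group Γ] [TopologicalSpace X] (α : Γ →* (X ≃ₜ X))
    (U : Set (Set X)) : EReal :=
  limsup (fun F : Finset Γ =>
    ENNReal.log (coverNumber (coverJoin α U F) : ℝ≥0∞) / (F.card : EReal)) (invarianceFilter Γ)

/-- The topological entropy of an action by homeomorphisms: the supremum of the entropies with
respect to finite open covers. -/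
def topEntropy {Γ X : Type*} [Group Γ] [TopologicalSpace X] (α : Γ →* (X ≃ₜ X)) : EReal :=
  ⨆ (U : Set (Set X)) (_ : U.Finite ∧ (∀ V ∈ U, IsOpen V) ∧ ⋃₀ U = Set.univ), coverEntropy α U

/-! ## Separated sets -/

/-- `d_{ϑ,F,∞}(x, y) = max_{γ ∈ F} ϑ(γ x, γ y)`. -/
def orbitDist {Γ X : Type*} [Group Γ] [TopologicalSpace X] (α : Γ →* (X ≃ₜ X))
    (ϑ : X → X → ℝ) (F : Finset Γ) (x y : X) : ℝ :=
  ⨆ γ : F, ϑ (α (γ : Γ) x) (α (γ : Γ) y)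

/-- `s_{ϑ,F,∞}(ε)`: the maximal cardinality of a set whose distinct points have `d_{ϑ,F,∞}`-distance
greater than `ε`. -/
def sepNumber {Γ X : Type*} [Group Γ] [TopologicalSpace X] (α : Γ →* (X ≃ₜ X))
    (ϑ : X → X → ℝ) (F : Finset Γ) (ε : ℝ) : ℕ∞ :=
  ⨆ (E : Set X) (_ : ∀ x ∈ E, ∀ y ∈ E, x ≠ y → ε < orbitDist α ϑ F x y), E.encard

/-! ## The algebraic action `α_f` -/

/-- `X_f = {h ∈ (ℝ/ℤ)^Γ : f h = 0}`, where `(f h)_{γ'} = ∑_γ f_γ h_{γ⁻¹ γ'}`. -/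
def algX {Γ : Type*} [Group Γ] (f : MonoidAlgebra ℤ Γ) : Set (Γ → UnitAddCircle) :=
  {h | ∀ t : Γ, ∑ s ∈ f.coeff.support, f.coeff s • h (s⁻¹ * t) = 0}

/-- The right shift `(γ h)_{γ'} = h_{γ' γ}` on `X_f`. -/
def algShift {Γ : Type*} [Group Γ] (f : MonoidAlgebra ℤ Γ) (γ : Γ) (h : algX f) : algX f :=
  ⟨fun t => h.1 (t * γ), fun t => by simpa only [mul_assoc] using h.2 (t * γ)⟩

theorem continuous_algShift {Γ : Type*} [Group Γ] (f : MonoidAlgebra ℤ Γ) (γ : Γ) :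
    Continuous (algShift f γ) := by
  refine continuous_induced_rng.2 (continuous_pi fun t => ?_)
  exact (continuous_apply (t * γ)).comp continuous_subtype_val

/-- The right shift action `α_f` of `Γ` on `X_f` by homeomorphisms. -/
def algAction {Γ : Type*} [Group Γ] (f : MonoidAlgebra ℤ Γ) : Γ →* (algX f ≃ₜ algX f) where
  toFun γ :=
    { toFun := algShift f γ
      invFun := algShift f γ⁻¹
      left_inv := fun h => by ext t; simp [algShift]
      right_inv := fun h => by ext t; simp [algShift]
      continuous_toFun := continuous_algShift f γ
      continuous_invFun := continuous_algShift f γ⁻¹ }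
  map_one' := by ext h t; simp [algShift]
  map_mul' a b := by ext h t; simp [algShift, mul_assoc]

/-- The pseudometric on `X_f` pulled back from the metric `min_m |t - t' - m|` of `ℝ/ℤ` along
`h ↦ h_e`. -/
def algPseudoDist {Γ : Type*} [Group Γ] (f : MonoidAlgebra ℤ Γ) (x y : algX f) : ℝ :=
  dist (x.1 1) (y.1 1)

/-- `‖f‖₁ = ∑_γ |f_γ|`. -/
def l1Norm {Γ : Type*} (f : MonoidAlgebra ℤ Γ) : ℝ :=
  ∑ s ∈ f.coeff.support, |(f.coeff s : ℝ)|

/-! ## Compressions -/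

/-- The embedding `ι_F : R[F] → RΓ`. -/
def embedFinset {Γ : Type*} (R : Type*) [CommRing R] (F : Finset Γ) :
    (F → R) →ₗ[R] MonoidAlgebra R Γ where
  toFun x := ∑ s : F, MonoidAlgebra.single (s : Γ) (x s)
  map_add' x y := by simp [Finset.sum_add_distrib]
  map_smul' c x := by simp [Finset.smul_sum]

/-- The restriction `p_F : RΓ → R[F]`. -/
def restrictFinset {Γ : Type*} (R : Type*) [CommRing R] (F : Finset Γ) :
    MonoidAlgebra R Γ →ₗ[R] (F → R) where
  toFun g := fun s => g.coeff (s : Γ)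
  map_add' x y := by ext; simp
  map_smul' c x := by ext; simp

/-- The compression `f_F = p_F ∘ f ∘ ι_F : R[F] → R[F]` of the left multiplication by `f`. -/
def compression {Γ : Type*} [Group Γ] {R : Type*} [CommRing R] (f : MonoidAlgebra R Γ)
    (F : Finset Γ) : (F → R) →ₗ[R] (F → R) :=
  restrictFinset R F ∘ₗ LinearMap.mulLeft R f ∘ₗ embedFinset R F

/-- `|ℤ[F] / f_F ℤ[F]|`, which may be infinite. -/
def cokerCard {Γ : Type*} [Group Γ] (f : MonoidAlgebra ℤ Γ) (F : Finset Γ) : ℕ∞ :=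
  ENat.card ((F → ℤ) ⧸ LinearMap.range (compression f F))

/-- `det f_F`, the determinant of `f_F` acting on `ℂ[F]`. -/
def compressionDet {Γ : Type*} [Group Γ] (f : MonoidAlgebra ℤ Γ) (F : Finset Γ) : ℂ :=
  LinearMap.det (compression (MonoidAlgebra.mapRingHom Γ (Int.castRingHom ℂ) f) F)

/-! ## The group von Neumann algebra and the Fuglede–Kadison determinant -/

/-- The Hilbert space `ℓ²(Γ)`. -/
abbrev EllTwo (Γ : Type*) := lp (fun _ : Γ => ℂ) 2

/-- The isometry `g ↦ g ∘ e` of `ℓ²(Γ)`, for a permutation `e` of `Γ`. -/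
def ellTwoReindex {Γ : Type*} (e : Γ ≃ Γ) : EllTwo Γ →ₗᵢ[ℂ] EllTwo Γ where
  toFun g := ⟨fun t => g (e t), memℓp_gen (by
    have h := (lp.memℓp g).summable (by norm_num)
    exact (e.summable_iff (f := fun i => ‖g i‖ ^ (2 : ℝ≥0∞).toReal)).2 h)⟩
  map_add' g h := by ext t; rfl
  map_smul' c g := by ext t; rfl
  norm_map' g := by
    rw [lp.norm_eq_tsum_rpow (by norm_num), lp.norm_eq_tsum_rpow (by norm_num)]
    congr 1
    exact e.tsum_eq (fun i => ‖g i‖ ^ (2 : ℝ≥0∞).toReal)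

/-- Left translation `(γ g)_{γ'} = g_{γ⁻¹ γ'}` on `ℓ²(Γ)`. -/
def leftShift {Γ : Type*} [Group Γ] (s : Γ) : EllTwo Γ →L[ℂ] EllTwo Γ :=
  (ellTwoReindex (Equiv.mulLeft s⁻¹)).toContinuousLinearMap

/-- Right translation `(h γ)_{γ'} = h_{γ' γ}` on `ℓ²(Γ)`. -/
def rightShift {Γ : Type*} [Group Γ] (s : Γ) : EllTwo Γ →L[ℂ] EllTwo Γ :=
  (ellTwoReindex (Equiv.mulRight s)).toContinuousLinearMap

/-- The left group von Neumann algebra `𝓛Γ`: the bounded operators on `ℓ²(Γ)` that commute with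
the right translations (and their adjoints, which are again right translations). -/
def groupVN (Γ : Type*) [Group Γ] : StarSubalgebra ℂ (EllTwo Γ →L[ℂ] EllTwo Γ) :=
  StarSubalgebra.centralizer ℂ (Set.range (rightShift (Γ := Γ)))

theorem star_rightShift {Γ : Type*} [Group Γ] (s : Γ) :
    star (rightShift s) = rightShift (s⁻¹) := by
  rw [ContinuousLinearMap.star_eq_adjoint]
  symm
  rw [ContinuousLinearMap.eq_adjoint_iff]
  intro x y
  rw [lp.inner_eq_tsum, lp.inner_eq_tsum,
    ← (Equiv.mulRight s).tsum_eq (fun i => inner ℂ ((rightShift s⁻¹ x) i) (y i))]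
  refine tsum_congr fun i => ?_
  change inner ℂ (x (i * s * s⁻¹)) (y (i * s)) = inner ℂ (x i) (y (i * s))
  rw [mul_inv_cancel_right]

theorem leftShift_mem_groupVN {Γ : Type*} [Group Γ] (s : Γ) : leftShift s ∈ groupVN Γ := by
  have key : ∀ t : Γ, rightShift t * leftShift s = leftShift s * rightShift t := by
    intro t
    ext x i
    change x (s⁻¹ * (i * t)) = x (s⁻¹ * i * t)
    rw [mul_assoc]
  rw [groupVN, StarSubalgebra.mem_centralizer_iff]
  rintro _ ⟨t, rfl⟩
  exact ⟨key t, by rw [star_rightShift]; exact key t⁻¹⟩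

/-- An element `f` of `ℤΓ` as an element of `𝓛Γ`, acting on `ℓ²(Γ)` by left multiplication
`(f g)_{γ'} = ∑_γ f_γ g_{γ⁻¹ γ'}`. -/
def toVN {Γ : Type*} [Group Γ] (f : MonoidAlgebra ℤ Γ) : groupVN Γ :=
  ∑ s ∈ f.coeff.support, (f.coeff s : ℂ) • (⟨leftShift s, leftShift_mem_groupVN s⟩ : groupVN Γ)

/-- The canonical trace `tr a = ⟨a e, e⟩` of `𝓛Γ`. -/
def vnTrace {Γ : Type*} [Group Γ] (a : EllTwo Γ →L[ℂ] EllTwo Γ) : ℂ :=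
  open scoped Classical in
  inner ℂ (lp.single 2 (1 : Γ) (1 : ℂ) : EllTwo Γ) (a (lp.single 2 (1 : Γ) (1 : ℂ)))

/-- The Fuglede–Kadison determinant `exp (½ tr (log (a* a)))` of an invertible `a ∈ 𝓛Γ`, where the
logarithm is given by the continuous functional calculus (and the trace is real). -/
def fkDet {Γ : Type*} [Group Γ] (a : groupVN Γ) : ℝ :=
  Real.exp ((1 / 2) * (vnTrace (CFC.log ((star a * a : groupVN Γ) : EllTwo Γ →L[ℂ] EllTwo Γ))).re)

end

noncomputable section

open scoped Classical

/-! Positivity and invertibility give `c > 0` with `c‖x‖² ≤ ⟨x, f x⟩`. On vectors supported in `F`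
this says that every `f_F` has its spectrum in `[c, ‖f‖]`, uniformly in `F`. So `f_F` is invertible
over `ℝ`, and `f_F ℤ[F]` has index `|det f_F|` in `ℤ[F]`. All limits are taken along
`invarianceFilter` and transferred to the net at the end.

Determinant: on `[c, ‖f‖]` the logarithm is uniformly close to a polynomial, and `tr (f_F ^ j) /
|F|` tends to `(f ^ j)_e`, because the diagonal entries agree off a boundary of vanishing density
(`tendsto_trace_pow`, `tendsto_log_det`).

Separated sets: lift a point of `X_f` to a real function and apply `f_F`. The result is integral off
the boundary of `F`, so the point is coded by a class of `ℤ[F]/f_F ℤ[F]` and a small error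
(`encard_le_of_isSep`). Conversely a class has a bounded representative `w`, and `f⁻¹ w` mod 1 lies
in `X_f`. If `ε‖f‖₁ ≤ 1/2`, points that are `ε`-close on `F` come from classes differing only by an
error on the boundary (`natAbs_det_le`). The errors are lattice points of `ℓ¹`-balls, of radius
`O(|∂F|)` in dimension `|F|` or of radius `O(|F|)` in dimension `|∂F|`. In both cases their number
is `exp(o(|F|))` (`ncard_latticeBall_le`, `tendsto_of_growth_bounds`).

Entropy: the growth rate of separated sets is thus the same for all small `ε`, and comparison with
open covers identifies it with the entropy (`topEntropy_eq`). -/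

/-! ### Compressions as integer matrices. -/

/-- The matrix of the compression `f_F`. -/
def compMat {Γ : Type*} [Group Γ] {R : Type*} [CommRing R] (f : MonoidAlgebra R Γ)
    (F : Finset Γ) : Matrix F F R :=
  Matrix.of fun s t => f.coeff ((s : Γ) * (t : Γ)⁻¹)

theorem compression_eq_toLin {Γ : Type*} [Group Γ] {R : Type*} [CommRing R]
    (f : MonoidAlgebra R Γ) (F : Finset Γ) : compression f F = Matrix.toLin' (compMat f F) := by
  refine LinearMap.ext fun x => funext fun s => ?_
  have : (compression f F) x s
      = (f * ∑ t : F, MonoidAlgebra.single (t : Γ) (x t)).coeff (s : Γ) := rfl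
  rw [this, Finset.mul_sum, MonoidAlgebra.coeff_sum, Finset.sum_apply']
  simp [compMat, Matrix.mulVec, dotProduct]

theorem compressionDet_eq {Γ : Type*} [Group Γ] (f : MonoidAlgebra ℤ Γ) (F : Finset Γ) :
    compressionDet f F = (((compMat f F).det : ℤ) : ℂ) := by
  rw [compressionDet, compression_eq_toLin, LinearMap.det_toLin']
  have : compMat (MonoidAlgebra.mapRingHom Γ (Int.castRingHom ℂ) f) F
      = (Int.castRingHom ℂ).mapMatrix (compMat f F) := by
    ext s t
    simp [compMat]
  rw [this, ← RingHom.map_det]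
  rfl

/-- A nonzero determinant makes `f_F` injective, so its image is a full-rank sublattice, of index
`|det|`. -/
theorem cokerCard_eq {Γ : Type*} [Group Γ] (f : MonoidAlgebra ℤ Γ) (F : Finset Γ)
    (h : (compMat f F).det ≠ 0) : cokerCard f F = ((compMat f F).det.natAbs : ℕ∞) ∧
      Nat.card ((F → ℤ) ⧸ LinearMap.range (compression f F)) = (compMat f F).det.natAbs ∧
      Finite ((F → ℤ) ⧸ LinearMap.range (compression f F)) := by
  have hinj : Function.Injective (compression f F) := by
    rw [compression_eq_toLin, Matrix.toLin'_apply']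
    exact Matrix.mulVec_injective_of_det_ne_zero h
  have hc := Submodule.natAbs_det_equiv _ (LinearEquiv.ofInjective _ hinj)
  have hd : LinearMap.det (compression f F) = (compMat f F).det := by
    rw [compression_eq_toLin, LinearMap.det_toLin']
  have hc2 : Nat.card ((F → ℤ) ⧸ LinearMap.range (compression f F))
      = (compMat f F).det.natAbs := by
    rw [← hc, ← hd]
    rfl
  have hfin : Finite ((F → ℤ) ⧸ LinearMap.range (compression f F)) :=
    Nat.finite_of_card_ne_zero (by rw [hc2]; exact Int.natAbs_ne_zero.2 h)
  exact ⟨by rw [cokerCard, ENat.card_eq_coe_natCard, hc2], hc2, hfin⟩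

/-! ### Left multiplication on `ℓ²(Γ)` in coordinates. -/

/-- Left multiplication by `f` on `ℓ²(Γ)`. -/
def leftMul {Γ : Type*} [Group Γ] (f : MonoidAlgebra ℤ Γ) : EllTwo Γ →L[ℂ] EllTwo Γ :=
  (toVN f : groupVN Γ)

/-- The standard basis vector `δ_t` of `ℓ²(Γ)`. -/
def delta {Γ : Type*} (t : Γ) : EllTwo Γ := lp.single 2 t (1 : ℂ)

theorem delta_apply {Γ : Type*} (t u : Γ) : (delta t : EllTwo Γ) u = if u = t then 1 else 0 := by
  simp only [delta, lp.coeFn_single, Pi.single_apply]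

theorem leftMul_apply {Γ : Type*} [Group Γ] (f : MonoidAlgebra ℤ Γ) (x : EllTwo Γ) (t : Γ) :
    leftMul f x t = ∑ s ∈ f.coeff.support, (f.coeff s : ℂ) * x (s⁻¹ * t) := by
  have : leftMul f = ∑ s ∈ f.coeff.support, (f.coeff s : ℂ) • leftShift s := by
    simp [leftMul, toVN]
  rw [this, _root_.sum_apply, lp.coeFn_sum, Finset.sum_apply]
  rfl

theorem leftMul_delta_apply {Γ : Type*} [Group Γ] (f : MonoidAlgebra ℤ Γ) (u t : Γ) :
    leftMul f (delta u) t = (f.coeff (t * u⁻¹) : ℂ) := by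
  rw [leftMul_apply]
  simp only [delta_apply]
  rw [Finset.sum_eq_single (t * u⁻¹)]
  · simp
  · intro s _ hs
    rw [if_neg, mul_zero]
    rintro h
    apply hs
    rw [← h]; simp
  · intro h
    rw [Finsupp.notMem_support_iff.1 h]; simp

theorem inner_delta_left {Γ : Type*} (t : Γ) (x : EllTwo Γ) : inner ℂ (delta t) x = x t := by
  rw [delta, lp.inner_single_left]; simp

/-- The finitely supported vector of `ℓ²(Γ)` with entries `x` on `F`. -/
def embed {Γ : Type*} (F : Finset Γ) (x : F → ℝ) : EllTwo Γ := ∑ t : F, (x t : ℂ) • delta (t : Γ)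

theorem embed_apply {Γ : Type*} (F : Finset Γ) (x : F → ℝ) (t : Γ) :
    embed F x t = if h : t ∈ F then (x ⟨t, h⟩ : ℂ) else 0 := by
  rw [embed, lp.coeFn_sum, Finset.sum_apply]
  simp only [lp.coeFn_smul, Pi.smul_apply, delta_apply, smul_eq_mul, mul_ite, mul_one, mul_zero]
  split_ifs with h
  · rw [Finset.sum_eq_single ⟨t, h⟩]
    · simp
    · intro u _ hu
      rw [if_neg]
      rintro rfl
      exact hu rfl
    · simp
  · refine Finset.sum_eq_zero fun u _ => if_neg ?_
    rintro rfl
    exact h u.2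

theorem inner_embed {Γ : Type*} (F : Finset Γ) (x : F → ℝ) (y : EllTwo Γ) :
    inner ℂ (embed F x) y = ∑ t : F, (x t : ℂ) * y t := by
  simp [embed, inner_delta_left]

theorem norm_embed_sq {Γ : Type*} (F : Finset Γ) (x : F → ℝ) :
    ‖embed F x‖ ^ 2 = ∑ t : F, x t ^ 2 := by
  have h := inner_embed F x (embed F x)
  rw [inner_self_eq_norm_sq_to_K] at h
  have h2 : ∀ t : F, embed F x (t : Γ) = (x t : ℂ) := fun t => by
    rw [embed_apply, dif_pos t.2]
  simp only [h2] at h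
  have h3 : ((‖embed F x‖ ^ 2 : ℝ) : ℂ) = ((∑ t : F, x t ^ 2 : ℝ) : ℂ) := by
    push_cast
    simpa [sq] using h
  exact_mod_cast h3

/-! ### Consequences of positivity and invertibility. -/

section Positive

variable {Γ : Type*} [Group Γ] {f : MonoidAlgebra ℤ Γ}

theorem isSelfAdjoint_leftMul (hpos : ∃ b : groupVN Γ, toVN f = star b * b) :
    IsSelfAdjoint (leftMul f) := by
  obtain ⟨b, hb⟩ := hpos
  have : IsSelfAdjoint (toVN f) := by rw [hb]; exact IsSelfAdjoint.star_mul_self b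
  exact congrArg Subtype.val this

theorem exists_leftMul_inverse (hinv : IsUnit (toVN f)) :
    ∃ B : EllTwo Γ →L[ℂ] EllTwo Γ, leftMul f * B = 1 ∧ B * leftMul f = 1 := by
  obtain ⟨u, hu⟩ := hinv
  refine ⟨((↑u⁻¹ : groupVN Γ) : EllTwo Γ →L[ℂ] EllTwo Γ), ?_, ?_⟩
  · have := congrArg Subtype.val u.mul_inv
    rw [hu] at this
    exact this
  · have := congrArg Subtype.val u.inv_mul
    rw [hu] at this
    exact this

/-- Since `f = b* b`, the form is `‖b x‖²`, and `b` is bounded below because it has the left inverse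
`f⁻¹ b*`. -/
theorem exists_pos_le_inner_leftMul (hpos : ∃ b : groupVN Γ, toVN f = star b * b)
    (hinv : IsUnit (toVN f)) :
    ∃ c > 0, ∀ x : EllTwo Γ, c * ‖x‖ ^ 2 ≤ (inner ℂ x (leftMul f x)).re := by
  obtain ⟨b, hb⟩ := hpos
  obtain ⟨B, -, hB⟩ := exists_leftMul_inverse hinv
  have hA : leftMul f = ContinuousLinearMap.adjoint (b : EllTwo Γ →L[ℂ] EllTwo Γ) * b :=
    congrArg Subtype.val hb
  set b' : EllTwo Γ →L[ℂ] EllTwo Γ := (b : EllTwo Γ →L[ℂ] EllTwo Γ)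
  set D := B * ContinuousLinearMap.adjoint b' with hD
  have h1 : ∀ x, ‖x‖ ≤ (‖D‖ + 1) * ‖b' x‖ := fun x => by
    have : D (b' x) = x := by
      have := congrArg (fun T : EllTwo Γ →L[ℂ] EllTwo Γ => T x) hB
      rw [hA] at this
      exact this
    calc ‖x‖ = ‖D (b' x)‖ := by rw [this]
      _ ≤ ‖D‖ * ‖b' x‖ := D.le_opNorm _
      _ ≤ _ := by gcongr; linarith
  -- The summand 1 spares a proof that `D ≠ 0`.
  have hp : 0 < ‖D‖ + 1 := by positivity
  refine ⟨((‖D‖ + 1) ^ 2)⁻¹, by positivity, fun x => ?_⟩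
  have h2 : (inner ℂ x (leftMul f x)).re = ‖b' x‖ ^ 2 := by
    rw [hA]
    change (inner ℂ x (ContinuousLinearMap.adjoint b' (b' x))).re = _
    rw [ContinuousLinearMap.adjoint_inner_right, inner_self_eq_norm_sq_to_K]
    norm_cast
  rw [h2, inv_mul_le_iff₀ (by positivity), ← mul_pow]
  exact pow_le_pow_left₀ (norm_nonneg _) (h1 x) 2

theorem coeff_inv_eq (hpos : ∃ b : groupVN Γ, toVN f = star b * b) (s : Γ) :
    f.coeff s⁻¹ = f.coeff s := by
  have h := (isSelfAdjoint_leftMul hpos).isSymmetric (delta s) (delta 1)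
  have h' : inner ℂ (leftMul f (delta s)) (delta 1) = inner ℂ (delta s) (leftMul f (delta 1)) := h
  rw [← inner_conj_symm, inner_delta_left, inner_delta_left, leftMul_delta_apply,
    leftMul_delta_apply] at h'
  simp only [one_mul, inv_one, mul_one, map_intCast] at h'
  exact_mod_cast h'

theorem re_inner_leftMul_embed (F : Finset Γ) (x : F → ℝ) :
    (inner ℂ (embed F x) (leftMul f (embed F x))).re =
      ∑ t : F, x t * ∑ u : F, (f.coeff ((t : Γ) * (u : Γ)⁻¹) : ℝ) * x u := by
  have h : ∀ t : Γ, leftMul f (embed F x) t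
      = ((∑ u : F, (f.coeff (t * (u : Γ)⁻¹) : ℝ) * x u : ℝ) : ℂ) := fun t => by
    rw [embed, map_sum, lp.coeFn_sum, Finset.sum_apply]
    push_cast
    refine Finset.sum_congr rfl fun u _ => ?_
    rw [map_smul, lp.coeFn_smul, Pi.smul_apply, leftMul_delta_apply, smul_eq_mul, mul_comm]
  rw [inner_embed, Complex.re_sum]
  refine Finset.sum_congr rfl fun t _ => ?_
  rw [h, ← Complex.ofReal_mul, Complex.ofReal_re]

/-- Take `v = Re (f⁻¹ w)`: the coefficients of `f` are real, so real parts still solve the equation,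
on all of `Γ`. The constant `‖f⁻¹‖²` does not depend on `F`. -/
theorem exists_real_solution (hinv : IsUnit (toVN f)) :
    ∃ C : ℝ, 0 ≤ C ∧ ∀ (F : Finset Γ) (w : F → ℝ), ∃ v : Γ → ℝ,
      (∀ t, ∑ s ∈ f.coeff.support, (f.coeff s : ℝ) * v (s⁻¹ * t)
        = if h : t ∈ F then w ⟨t, h⟩ else 0) ∧
      ∑ t : F, v t ^ 2 ≤ C * ∑ t : F, w t ^ 2 := by
  obtain ⟨B, hB, -⟩ := exists_leftMul_inverse hinv
  refine ⟨‖B‖ ^ 2, by positivity, fun F w => ⟨fun t => (B (embed F w) t).re, fun t => ?_, ?_⟩⟩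
  · have h : leftMul f (B (embed F w)) = embed F w :=
      congrArg (fun T : EllTwo Γ →L[ℂ] EllTwo Γ => T (embed F w)) hB
    have h2 := leftMul_apply f (B (embed F w)) t
    rw [h, embed_apply] at h2
    have h3 := congrArg Complex.re h2
    rw [Complex.re_sum] at h3
    rw [show (if h : t ∈ F then w ⟨t, h⟩ else 0)
      = (if h : t ∈ F then (w ⟨t, h⟩ : ℂ) else 0).re by split_ifs <;> simp, h3]
    refine Finset.sum_congr rfl fun s _ => ?_
    rw [← Complex.ofReal_intCast, Complex.re_ofReal_mul]
  · rw [← norm_embed_sq F w, ← mul_pow]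
    refine le_trans ?_ (pow_le_pow_left₀ (norm_nonneg _) (B.le_opNorm (embed F w)) 2)
    have h := lp.sum_rpow_le_norm_rpow (p := 2) (by norm_num) (B (embed F w)) F
    simp only [ENNReal.toReal_ofNat, Real.rpow_ofNat] at h
    refine le_trans ?_ h
    rw [← Finset.sum_coe_sort F]
    refine Finset.sum_le_sum fun t _ => ?_
    rw [← sq_abs]
    exact pow_le_pow_left₀ (abs_nonneg _) (Complex.abs_re_le_norm _) 2

/-- The compression of `f` as a real matrix. -/
def realMat (f : MonoidAlgebra ℤ Γ) (F : Finset Γ) : Matrix F F ℝ :=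
  Matrix.of fun s t => (f.coeff ((s : Γ) * (t : Γ)⁻¹) : ℝ)

theorem exists_quadratic_form_bounds (hpos : ∃ b : groupVN Γ, toVN f = star b * b)
    (hinv : IsUnit (toVN f)) :
    ∃ c > 0, (∀ (F : Finset Γ) (x : F → ℝ),
      c * ∑ t, x t ^ 2 ≤ ∑ t, x t * (realMat f F).mulVec x t) ∧
      ∀ x : EllTwo Γ, c * ‖x‖ ^ 2 ≤ (inner ℂ x (leftMul f x)).re := by
  obtain ⟨c, hc, h⟩ := exists_pos_le_inner_leftMul hpos hinv
  refine ⟨c, hc, fun F x => ?_, h⟩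
  have := h (embed F x)
  rwa [norm_embed_sq, re_inner_leftMul_embed] at this

theorem quadratic_form_le (F : Finset Γ) (x : F → ℝ) :
    ∑ t, x t * (realMat f F).mulVec x t ≤ ‖leftMul f‖ * ∑ t, x t ^ 2 := by
  have h : (inner ℂ (embed F x) (leftMul f (embed F x))).re ≤ ‖leftMul f‖ * ‖embed F x‖ ^ 2 := by
    calc _ ≤ ‖inner ℂ (embed F x) (leftMul f (embed F x))‖ := Complex.re_le_norm _
      _ ≤ ‖embed F x‖ * ‖leftMul f (embed F x)‖ := norm_inner_le_norm _ _
      _ ≤ ‖embed F x‖ * (‖leftMul f‖ * ‖embed F x‖) := by gcongr; exact (leftMul f).le_opNorm _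
      _ = _ := by ring
  rwa [norm_embed_sq, re_inner_leftMul_embed] at h

theorem isHermitian_realMat (hpos : ∃ b : groupVN Γ, toVN f = star b * b) (F : Finset Γ) :
    (realMat f F).IsHermitian := by
  ext s t
  simp only [realMat, Matrix.conjTranspose_apply, Matrix.of_apply, star_trivial]
  rw [← coeff_inv_eq hpos ((s : Γ) * (t : Γ)⁻¹)]
  simp

end Positive

/-! ## Lattice points in `ℓ¹`-balls -/

/-- `∑_{k ∈ ℤ} e^{-s|k|}`. -/
def latticeGrowth (s : ℝ) : ℝ := (1 + Real.exp (-s)) / (1 - Real.exp (-s))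

theorem one_le_latticeGrowth {s : ℝ} (hs : 0 < s) : 1 ≤ latticeGrowth s := by
  have h1 : Real.exp (-s) < 1 := Real.exp_lt_one_iff.2 (by linarith)
  have h2 := Real.exp_pos (-s)
  rw [latticeGrowth, le_div_iff₀ (by linarith)]
  linarith

theorem sum_exp_neg_abs_le {s : ℝ} (hs : 0 < s) (N : ℕ) :
    ∑ k ∈ Finset.Icc (-(N : ℤ)) N, Real.exp (-(s * |(k : ℝ)|)) ≤ latticeGrowth s := by
  have h1 : Real.exp (-s) < 1 := Real.exp_lt_one_iff.2 (by linarith)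
  set q := Real.exp (-s) with hq
  have hq0 : 0 < q := Real.exp_pos _
  have key : ∀ N : ℕ, ∑ k ∈ Finset.Icc (-(N : ℤ)) N, Real.exp (-(s * |(k : ℝ)|))
      = (1 + q - 2 * q ^ (N + 1)) / (1 - q) := by
    intro N
    have hne : (1 - q) ≠ 0 := by linarith
    induction N with
    | zero => simp; field_simp; ring
    | succ N ih =>
      have hI : Finset.Icc (-((N + 1 : ℕ) : ℤ)) ((N + 1 : ℕ) : ℤ)
          = insert (-((N + 1 : ℕ) : ℤ)) (insert ((N + 1 : ℕ) : ℤ) (Finset.Icc (-(N : ℤ)) N)) := by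
        ext k
        simp only [Finset.mem_Icc, Finset.mem_insert]
        omega
      have hE : Real.exp (-(s * (N + 1))) = q ^ (N + 1) := by
        rw [hq, ← Real.exp_nat_mul]; congr 1; push_cast; ring
      have ha : |((N : ℝ) + 1)| = N + 1 := abs_of_nonneg (by positivity)
      have hb : |(-1 + -(N : ℝ))| = N + 1 := by
        rw [abs_of_nonpos] <;> [ring; linarith [N.cast_nonneg (α := ℝ)]]
      rw [hI, Finset.sum_insert, Finset.sum_insert, ih]
      · push_cast
        rw [abs_neg, ha, hE]
        field_simp; ring
      · simp
      · simp only [Finset.mem_Icc, Finset.mem_insert]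
        omega
  rw [key, latticeGrowth]
  have : 0 < 1 - q := by linarith
  gcongr
  have := pow_pos hq0 (N + 1)
  linarith

/-- The lattice points of the `ℓ¹`-ball of radius `T`. -/
def latticeBall (ι : Type*) [Fintype ι] (T : ℝ) : Set (ι → ℤ) := {k | ∑ i, |(k i : ℝ)| ≤ T}

theorem latticeBall_subset (ι : Type*) [Fintype ι] (T : ℝ) :
    latticeBall ι T ⊆ Fintype.piFinset fun _ : ι => Finset.Icc (-(⌈T⌉₊ : ℤ)) ⌈T⌉₊ := by
  intro k hk
  simp only [Finset.mem_coe, Fintype.mem_piFinset, Finset.mem_Icc]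
  intro i
  have h1 : |(k i : ℝ)| ≤ T :=
    (Finset.single_le_sum (f := fun i => |(k i : ℝ)|) (fun _ _ => abs_nonneg _)
      (Finset.mem_univ i)).trans hk
  have h2 : |(k i : ℝ)| ≤ (⌈T⌉₊ : ℝ) := h1.trans (Nat.le_ceil _)
  rw [← abs_le]
  exact_mod_cast h2

theorem finite_latticeBall (ι : Type*) [Fintype ι] (T : ℝ) : (latticeBall ι T).Finite :=
  (Finset.finite_toSet _).subset (latticeBall_subset ι T)

/-- An exponential Chebyshev bound: each point of the ball satisfies `1 ≤ exp (s (T - ‖k‖₁))`, and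
the sum over a surrounding box factors over coordinates. Large `s` suits a small radius in high
dimension, small `s` a large radius in low dimension. -/
theorem ncard_latticeBall_le (ι : Type*) [Fintype ι] (T : ℝ) {s : ℝ} (hs : 0 < s) :
    ((latticeBall ι T).ncard : ℝ) ≤ Real.exp (s * T) * latticeGrowth s ^ Fintype.card ι := by
  set I := Finset.Icc (-(⌈T⌉₊ : ℤ)) ⌈T⌉₊
  have hfin := finite_latticeBall ι T
  have hsub : hfin.toFinset ⊆ Fintype.piFinset fun _ : ι => I := fun k hk =>
    latticeBall_subset ι T (hfin.mem_toFinset.1 hk)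
  rw [Set.ncard_eq_toFinset_card _ hfin]
  calc (hfin.toFinset.card : ℝ) = ∑ k ∈ hfin.toFinset, (1 : ℝ) := by simp
    _ ≤ ∑ k ∈ hfin.toFinset, Real.exp (s * T) * ∏ i, Real.exp (-(s * |(k i : ℝ)|)) := by
        refine Finset.sum_le_sum fun k hk => ?_
        have hk' : ∑ i, |(k i : ℝ)| ≤ T := hfin.mem_toFinset.1 hk
        rw [← Real.exp_sum, ← Real.exp_add, Real.one_le_exp_iff, Finset.sum_neg_distrib,
          ← Finset.mul_sum]
        nlinarith
    _ ≤ ∑ k ∈ Fintype.piFinset fun _ : ι => I,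
          Real.exp (s * T) * ∏ i, Real.exp (-(s * |(k i : ℝ)|)) :=
        Finset.sum_le_sum_of_subset_of_nonneg hsub fun _ _ _ => by positivity
    _ = Real.exp (s * T) * ∏ _i : ι, ∑ k ∈ I, Real.exp (-(s * |(k : ℝ)|)) := by
        rw [← Finset.mul_sum, Finset.prod_univ_sum]
    _ ≤ _ := by
        rw [Finset.prod_const, Finset.card_univ]
        gcongr
        exact sum_exp_neg_abs_le hs _

/-! ## Separated subsets of `X_f` -/

theorem sum_abs_coeff_le {Γ : Type*} {f : MonoidAlgebra ℤ Γ} {ι : Type*} [Fintype ι]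
    (e : ι → Γ) (he : Function.Injective e) :
    ∑ i, |(f.coeff (e i) : ℝ)| ≤ l1Norm f := by
  rw [← Finset.sum_image (f := fun s => |(f.coeff s : ℝ)|) (s := Finset.univ) he.injOn, l1Norm]
  rw [← Finset.sum_filter_ne_zero]
  refine Finset.sum_le_sum_of_subset_of_nonneg (fun s hs => ?_) fun _ _ _ => abs_nonneg _
  refine Finsupp.mem_support_iff.2 fun h => (Finset.mem_filter.1 hs).2 ?_
  rw [h]; simp

section Separated

variable {Γ : Type*} [Group Γ] {f : MonoidAlgebra ℤ Γ}

theorem orbitDist_le_iff {F : Finset Γ} {ε : ℝ} (hε : 0 ≤ ε) (x y : algX f) :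
    orbitDist (algAction f) (algPseudoDist f) F x y ≤ ε ↔ ∀ t ∈ F, dist (x.1 t) (y.1 t) ≤ ε := by
  have h : ∀ t : Γ, algPseudoDist f (algAction f t x) (algAction f t y)
      = dist (x.1 t) (y.1 t) := fun t => by
    change dist (x.1 (1 * t)) (y.1 (1 * t)) = _
    rw [one_mul]
  simp only [orbitDist, h]
  constructor
  · intro H t ht
    exact (le_ciSup (f := fun γ : F => dist (x.1 γ) (y.1 γ)) (Set.finite_range _).bddAbove
      ⟨t, ht⟩).trans H
  · intro H
    exact Real.iSup_le (fun t => H t t.2) hε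

/-- `E` is separated at scale `ε` on the coordinates in `F`. -/
def IsSep (F : Finset Γ) (ε : ℝ) (E : Set (algX f)) : Prop :=
  ∀ x ∈ E, ∀ y ∈ E, x ≠ y → ε < orbitDist (algAction f) (algPseudoDist f) F x y

theorem encard_le_sepNumber {F : Finset Γ} {ε : ℝ} {E : Set (algX f)} (hE : IsSep F ε E) :
    E.encard ≤ sepNumber (algAction f) (algPseudoDist f) F ε :=
  le_iSup₂_of_le E hE le_rfl

/-- A maximal separated subset is `ε`-dense. Zorn's lemma gives one without knowing that separated
sets are finite. -/
theorem exists_maximal_sep {F : Finset Γ} {ε : ℝ} (hε : 0 ≤ ε) (Y : Set (algX f)) :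
    ∃ E ⊆ Y, IsSep F ε E ∧ ∀ y ∈ Y, ∃ x ∈ E, ∀ t ∈ F, dist (y.1 t) (x.1 t) ≤ ε := by
  obtain ⟨E, hE⟩ := zorn_subset {E : Set (algX f) | E ⊆ Y ∧ IsSep F ε E} (by
    intro c hc hchain
    refine ⟨⋃₀ c, ⟨Set.sUnion_subset fun E hE => (hc hE).1, ?_⟩,
      fun E hE => Set.subset_sUnion_of_mem hE⟩
    rintro x ⟨E₁, h₁, hx⟩ y ⟨E₂, h₂, hy⟩ hxy
    rcases hchain.total h₁ h₂ with h | h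
    · exact (hc h₂).2 x (h hx) y hy hxy
    · exact (hc h₁).2 x hx y (h hy) hxy)
  refine ⟨E, hE.prop.1, hE.prop.2, fun y hy => ?_⟩
  by_contra hcon
  push Not at hcon
  have hlt : ∀ x ∈ E, ε < orbitDist (algAction f) (algPseudoDist f) F x y ∧
      ε < orbitDist (algAction f) (algPseudoDist f) F y x := fun x hx => by
    obtain ⟨t, ht, htd⟩ := hcon x hx
    rw [← not_le, ← not_le, orbitDist_le_iff hε, orbitDist_le_iff hε]
    exact ⟨fun H => absurd (H t ht) (by rw [dist_comm]; exact htd.not_ge),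
      fun H => absurd (H t ht) htd.not_ge⟩
  have hins : insert y E ⊆ E := hE.le_of_ge (y := insert y E)
    ⟨Set.insert_subset hy hE.prop.1, by
      rintro a (rfl | ha) b (rfl | hb) hab
      · exact absurd rfl hab
      · exact (hlt b hb).2
      · exact (hlt a ha).1
      · exact hE.prop.2 a ha b hb hab⟩ (Set.subset_insert y E)
  obtain ⟨t, -, ht⟩ := hcon y (hins (Set.mem_insert y E))
  rw [dist_self] at ht
  exact absurd ht hε.not_gt

theorem exists_lift (h : UnitAddCircle) : ∃ t : ℝ, 0 ≤ t ∧ t < 1 ∧ (t : UnitAddCircle) = h := by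
  obtain ⟨t, rfl⟩ := QuotientAddGroup.mk_surjective h
  refine ⟨Int.fract t, Int.fract_nonneg t, Int.fract_lt_one t, ?_⟩
  rw [← sub_eq_zero, ← AddCircle.coe_sub, AddCircle.coe_eq_zero_iff]
  exact ⟨-⌊t⌋, by rw [Int.fract]; simp⟩

theorem dist_coe_le (a b : ℝ) (m : ℤ) : dist (a : UnitAddCircle) b ≤ |a - b - m| := by
  rw [dist_eq_norm, ← AddCircle.coe_sub, UnitAddCircle.norm_eq]
  exact round_le (a - b) m

theorem dist_coe_eq (a b : ℝ) : dist (a : UnitAddCircle) b = |a - b - round (a - b)| := by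
  rw [dist_eq_norm, ← AddCircle.coe_sub, UnitAddCircle.norm_eq]

/-- The convolution `f g` for a real function `g`. -/
def conv (f : MonoidAlgebra ℤ Γ) (g : Γ → ℝ) (t : Γ) : ℝ :=
  ∑ s ∈ f.coeff.support, (f.coeff s : ℝ) * g (s⁻¹ * t)

theorem coe_mem_algX_iff (g : Γ → ℝ) :
    (fun t => (g t : UnitAddCircle)) ∈ algX f ↔ ∀ t, ∃ m : ℤ, conv f g t = m := by
  have h : ∀ t : Γ, ∑ s ∈ f.coeff.support, f.coeff s • (g (s⁻¹ * t) : UnitAddCircle)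
      = (conv f g t : UnitAddCircle) := fun t => by
    rw [conv]
    have : ∀ x : ℝ, (x : UnitAddCircle) =
        (QuotientAddGroup.mk' (AddSubgroup.zmultiples (1 : ℝ))) x :=
      fun x => rfl
    rw [this, map_sum]
    refine Finset.sum_congr rfl fun s _ => ?_
    rw [← zsmul_eq_mul, map_zsmul]
    rfl
  refine forall_congr' fun t => ?_
  rw [h, AddCircle.coe_eq_zero_iff]
  simp [eq_comm]

/-- The points `t ∈ F` at which the convolution with `f` involves values outside `F`. -/
def bdry (f : MonoidAlgebra ℤ Γ) (F : Finset Γ) : Finset Γ :=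
  F.filter fun t => ∃ s ∈ f.coeff.support, s⁻¹ * t ∉ F

/-- Off the boundary the convolution only reads values inside `F`, so compressing loses nothing. -/
theorem conv_eq_mulVec {F : Finset Γ} (g : Γ → ℝ) {t : Γ} (ht : t ∈ F) (htb : t ∉ bdry f F) :
    conv f g t = (realMat f F).mulVec (fun u => g u) ⟨t, ht⟩ := by
  have hint : ∀ s ∈ f.coeff.support, s⁻¹ * t ∈ F := by
    intro s hs
    by_contra hcon
    exact htb (Finset.mem_filter.2 ⟨ht, s, hs, hcon⟩)
  have h : (realMat f F).mulVec (fun u => g u) ⟨t, ht⟩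
      = ∑ u ∈ F, (f.coeff (t * u⁻¹) : ℝ) * g u := by
    rw [← Finset.sum_coe_sort F]; rfl
  rw [h, conv]
  refine Finset.sum_of_injOn (fun s => s⁻¹ * t) ?_ ?_ ?_ ?_
  · intro a _ b _ hab
    simpa using hab
  · intro s hs
    exact hint s hs
  · intro u _ hu
    have : f.coeff (t * u⁻¹) = 0 := by
      by_contra hne
      exact hu ⟨t * u⁻¹, Finsupp.mem_support_iff.2 hne, by simp⟩
    rw [this]; simp
  · intro s _
    simp

/-- The absolute row sums of the matrix are at most `‖f‖₁`; the `ℓ¹` version below uses the column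
sums. -/
theorem abs_mulVec_le {F : Finset Γ} {x : F → ℝ} {r : ℝ} (hx : ∀ t, |x t| ≤ r) (t : F) :
    |(realMat f F).mulVec x t| ≤ l1Norm f * r := by
  have h0 : 0 ≤ r := (abs_nonneg _).trans (hx t)
  calc _ ≤ ∑ u : F, |(f.coeff ((t : Γ) * (u : Γ)⁻¹) : ℝ) * x u| := Finset.abs_sum_le_sum_abs _ _
    _ ≤ ∑ u : F, |(f.coeff ((t : Γ) * (u : Γ)⁻¹) : ℝ)| * r := by
        refine Finset.sum_le_sum fun u _ => ?_
        rw [abs_mul]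
        exact mul_le_mul_of_nonneg_left (hx u) (abs_nonneg _)
    _ ≤ _ := by
        rw [← Finset.sum_mul]
        exact mul_le_mul_of_nonneg_right
          (sum_abs_coeff_le (fun u : F => (t : Γ) * (u : Γ)⁻¹) fun a b h => by simpa using h) h0

theorem sum_abs_mulVec_le {F : Finset Γ} (x : F → ℝ) :
    ∑ t, |(realMat f F).mulVec x t| ≤ l1Norm f * ∑ t, |x t| := by
  calc _ ≤ ∑ t : F, ∑ u : F, |(f.coeff ((t : Γ) * (u : Γ)⁻¹) : ℝ)| * |x u| := by
        refine Finset.sum_le_sum fun t _ => ?_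
        simp only [← abs_mul]
        exact Finset.abs_sum_le_sum_abs _ _
    _ = ∑ u : F, (∑ t : F, |(f.coeff ((t : Γ) * (u : Γ)⁻¹) : ℝ)|) * |x u| := by
        rw [Finset.sum_comm]
        simp only [Finset.sum_mul]
    _ ≤ _ := by
        rw [Finset.mul_sum]
        refine Finset.sum_le_sum fun u _ => mul_le_mul_of_nonneg_right
          (sum_abs_coeff_le (fun t : F => (t : Γ) * (u : Γ)⁻¹) fun a b h => ?_) (abs_nonneg _)
        simpa using h

theorem realMat_mulVec_intCast {F : Finset Γ} (z : F → ℤ) :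
    (realMat f F).mulVec (fun t => (z t : ℝ)) = fun t => (((compMat f F).mulVec z t : ℤ) : ℝ) := by
  ext t
  simp [Matrix.mulVec, dotProduct, realMat, compMat]

theorem realMat_det (F : Finset Γ) : (realMat f F).det = ((compMat f F).det : ℤ) := by
  have : realMat f F = (Int.castRingHom ℝ).mapMatrix (compMat f F) := by
    ext s t
    simp [compMat, realMat]
  rw [this, ← RingHom.map_det]
  rfl

/-- Cauchy–Schwarz gives `c‖x‖² ≤ ⟨x, M x⟩ ≤ ‖x‖ ‖M x‖`, that is, `M⁻¹` has norm at most `1/c`. -/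
theorem sum_sq_le_of_quadratic {F : Finset Γ} {c : ℝ} (hc : 0 < c)
    (hq : ∀ x : F → ℝ, c * ∑ t, x t ^ 2 ≤ ∑ t, x t * (realMat f F).mulVec x t) (x : F → ℝ) :
    ∑ t, x t ^ 2 ≤ (c ^ 2)⁻¹ * ∑ t, (realMat f F).mulVec x t ^ 2 := by
  have h := hq x
  have hcs := Finset.sum_mul_sq_le_sq_mul_sq Finset.univ x ((realMat f F).mulVec x)
  set a := ∑ t, x t ^ 2
  set b := ∑ t, (realMat f F).mulVec x t ^ 2
  have ha : 0 ≤ a := Finset.sum_nonneg fun _ _ => sq_nonneg _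
  have hb : 0 ≤ b := Finset.sum_nonneg fun _ _ => sq_nonneg _
  have h2 : (c * a) ^ 2 ≤ a * b := (pow_le_pow_left₀ (by positivity) h 2).trans hcs
  rcases ha.eq_or_lt with h0 | h0
  · rw [← h0]; positivity
  · rw [le_inv_mul_iff₀ (by positivity)]
    nlinarith

end Separated

/-! ### Comparison of separated sets with `ℤ[F]/f_F ℤ[F]`. -/

theorem abs_round_le_two_mul (x : ℝ) : |(round x : ℝ)| ≤ 2 * |x| := by
  have h := round_le x 0
  simp only [Int.cast_zero, sub_zero] at h
  have h2 := abs_sub_abs_le_abs_sub (round x : ℝ) x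
  rw [abs_sub_comm] at h2
  linarith

theorem abs_intCast_le_sq (k : ℤ) : |(k : ℝ)| ≤ (k : ℝ) ^ 2 := by
  rw [← Int.cast_abs, Int.abs_eq_natAbs]
  exact_mod_cast Int.natAbs_le_self_sq k

/-- Turns `ℓ²` bounds into `ℓ¹` bounds after rounding, because an integer satisfies `|k| ≤ k²`. -/
theorem abs_round_le_four_mul_sq (x : ℝ) : |(round x : ℝ)| ≤ 4 * x ^ 2 := by
  refine (abs_intCast_le_sq _).trans ?_
  rw [← sq_abs (round x : ℝ), ← sq_abs x]
  have := pow_le_pow_left₀ (abs_nonneg _) (abs_round_le_two_mul x) 2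
  linarith

section Counting

variable {Γ : Type*} [Group Γ] {f : MonoidAlgebra ℤ Γ}

theorem compMat_det_ne_zero {F : Finset Γ} {c : ℝ} (hc : 0 < c)
    (hq : ∀ x : F → ℝ, c * ∑ t, x t ^ 2 ≤ ∑ t, x t * (realMat f F).mulVec x t) :
    (compMat f F).det ≠ 0 := by
  intro h
  have h0 : (realMat f F).det = 0 := by rw [realMat_det, h]; simp
  obtain ⟨v, hv, hv0⟩ := Matrix.exists_mulVec_eq_zero_iff.2 h0
  have := sum_sq_le_of_quadratic hc hq v
  rw [hv0] at this
  simp only [Pi.zero_apply, ne_eq, OfNat.ofNat_ne_zero, not_false_eq_true, zero_pow,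
    Finset.sum_const_zero, mul_zero] at this
  refine hv (funext fun t => ?_)
  have h2 := (Finset.sum_eq_zero_iff_of_nonneg fun _ _ => sq_nonneg _).1
    (le_antisymm this (Finset.sum_nonneg fun t _ => sq_nonneg (v t))) t (Finset.mem_univ t)
  exact pow_eq_zero_iff (two_ne_zero) |>.1 h2

theorem exists_realMat_mulVec_eq {F : Finset Γ} (hdet : (compMat f F).det ≠ 0) (y : F → ℝ) :
    ∃ x, (realMat f F).mulVec x = y := by
  refine ⟨(realMat f F)⁻¹.mulVec y, ?_⟩
  rw [Matrix.mulVec_mulVec, Matrix.mul_nonsing_inv, Matrix.one_mulVec]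
  rw [realMat_det, isUnit_iff_ne_zero]
  exact_mod_cast hdet

theorem mk_eq_mk_iff {F : Finset Γ} (w w' : F → ℤ) :
    (Submodule.Quotient.mk w : (F → ℤ) ⧸ LinearMap.range (compression f F))
      = Submodule.Quotient.mk w' ↔ ∃ z, (compMat f F).mulVec z = w - w' := by
  rw [Submodule.Quotient.eq, compression_eq_toLin]
  rfl

/-- Each point is coded by a class `q` and a lattice point of small `ℓ¹`-norm, and the code
determines its coordinates on `F` up to `ε`. A separated set therefore injects into the codes. -/
theorem encard_le_of_isSep {F : Finset Γ} {c ε : ℝ} (hc : 0 < c) (hε : 0 < ε)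
    (hq : ∀ x : F → ℝ, c * ∑ t, x t ^ 2 ≤ ∑ t, x t * (realMat f F).mulVec x t)
    {E : Set (algX f)} (hE : IsSep F ε E) :
    E.encard ≤ (((compMat f F).det.natAbs *
      (latticeBall F (4 * (ε ^ 2)⁻¹ * (c ^ 2)⁻¹ * (bdry f F).card)).ncard : ℕ) : ℕ∞) := by
  have hdet := compMat_det_ne_zero hc hq
  obtain ⟨-, hcard, hfinQ⟩ := cokerCard_eq f F hdet
  set Q := (F → ℤ) ⧸ LinearMap.range (compression f F)
  set B := latticeBall F (4 * (ε ^ 2)⁻¹ * (c ^ 2)⁻¹ * (bdry f F).card)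
  choose rep hrep using fun q : Q => Submodule.Quotient.mk_surjective _ q
  choose base hbase using fun q : Q =>
    exists_realMat_mulVec_eq hdet (fun t => ((rep q t : ℤ) : ℝ))
  have key : ∀ x : algX f, ∃ (p : Q × (F → ℤ)), p.2 ∈ B ∧ ∃ y : F → ℝ,
      (∀ t : F, (y t : UnitAddCircle) = x.1 t) ∧
      ∀ t : F, |(y t - base p.1 t) - ε * p.2 t| ≤ ε / 2 := by
    intro x
    choose g hg0 hg1 hg using fun t => exists_lift (x.1 t)
    have hgx : ∀ t, ∃ m : ℤ, conv f g t = m := by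
      rw [← coe_mem_algX_iff]
      have : (fun t => (g t : UnitAddCircle)) = x.1 := funext hg
      rw [this]
      exact x.2
    set y := (realMat f F).mulVec (fun u => g u) with hy
    set w : F → ℤ := fun t => ⌊y t⌋ with hw
    set q : Q := Submodule.Quotient.mk w with hqw
    obtain ⟨z, hz⟩ := (mk_eq_mk_iff (f := f) w (rep q)).1 (by rw [← hqw, hrep])
    -- Here `M g = y`, `M z = ⌊y⌋ - rep q` and `M (base q) = rep q`, so `M r` is the fractional part
    -- of `y`.
    set r : F → ℝ := fun t => g t - z t - base q t with hr
    have hMr : ∀ t, (realMat f F).mulVec r t = Int.fract (y t) := fun t => by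
      have : r = (fun u : F => g u) - (fun t => (z t : ℝ)) - base q := rfl
      rw [this, Matrix.mulVec_sub, Matrix.mulVec_sub, realMat_mulVec_intCast, hbase, hz]
      simp only [Pi.sub_apply, Int.fract, hw, hy]
      push_cast
      ring
    -- Off the boundary `y` agrees with the convolution of `f` with a lift of a point of `X_f`,
    -- hence is an integer and `M r` vanishes there.
    have hMr2 : ∑ t, (realMat f F).mulVec r t ^ 2 ≤ (bdry f F).card := by
      have hle : ∀ t : F, (realMat f F).mulVec r t ^ 2
          ≤ if (t : Γ) ∈ bdry f F then (1 : ℝ) else 0 := fun t => by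
        rw [hMr]
        split_ifs with h
        · exact pow_le_one₀ (Int.fract_nonneg _) (Int.fract_lt_one _).le
        · obtain ⟨m, hm⟩ := hgx t
          rw [conv_eq_mulVec g t.2 h] at hm
          have : y t = m := hm
          rw [this]; simp
      refine (Finset.sum_le_sum fun t _ => hle t).trans ?_
      rw [Finset.sum_coe_sort F (fun t => if t ∈ bdry f F then (1 : ℝ) else 0), Finset.sum_boole]
      norm_cast
      exact Finset.card_le_card fun t ht => (Finset.mem_filter.1 ht).2
    refine ⟨(q, fun t => round (r t / ε)), ?_, fun t => g t - z t, fun t => ?_, fun t => ?_⟩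
    · change ∑ t, |((round (r t / ε) : ℤ) : ℝ)| ≤ _
      calc _ ≤ ∑ t, 4 * (r t / ε) ^ 2 := Finset.sum_le_sum fun t _ => abs_round_le_four_mul_sq _
        _ = 4 * (ε ^ 2)⁻¹ * ∑ t, r t ^ 2 := by
            rw [Finset.mul_sum]
            refine Finset.sum_congr rfl fun t _ => ?_
            rw [div_pow]; ring
        _ ≤ 4 * (ε ^ 2)⁻¹ * ((c ^ 2)⁻¹ * (bdry f F).card) := by
            gcongr
            exact (sum_sq_le_of_quadratic hc hq r).trans (by gcongr)
        _ = _ := by ring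
    · rw [← hg, ← sub_eq_zero, ← AddCircle.coe_sub, AddCircle.coe_eq_zero_iff]
      exact ⟨-z t, by simp⟩
    · have h := abs_sub_round (r t / ε)
      have h2 : r t - ε * round (r t / ε) = ε * (r t / ε - round (r t / ε)) := by
        field_simp
      change |r t - ε * round (r t / ε)| ≤ _
      rw [h2, abs_mul, abs_of_pos hε]
      nlinarith
  choose φ hφB y hyx hyk using key
  -- Two lifts with the same code lie within `ε/2` of the same vector `base q + ε k`.
  have hinj : Set.InjOn φ E := by
    intro a ha b hb hab
    by_contra hne
    refine absurd (hE a ha b hb hne) (not_lt.2 ((orbitDist_le_iff hε.le a b).2 fun t ht => ?_))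
    have h1 := hyk a ⟨t, ht⟩
    have h2 := hyk b ⟨t, ht⟩
    rw [hab] at h1
    rw [← hyx a ⟨t, ht⟩, ← hyx b ⟨t, ht⟩]
    refine (dist_coe_le _ _ 0).trans ?_
    rw [abs_le] at *
    push_cast
    constructor <;> linarith [h1.1, h1.2, h2.1, h2.2]
  have hB := finite_latticeBall F (4 * (ε ^ 2)⁻¹ * (c ^ 2)⁻¹ * (bdry f F).card)
  have hmaps : Set.MapsTo φ E ((Set.univ : Set Q) ×ˢ B) := fun x _ => ⟨Set.mem_univ _, hφB x⟩
  refine (Set.encard_le_encard_of_injOn hmaps hinj).trans ?_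
  rw [← (Set.finite_univ.prod hB).cast_ncard_eq, Set.ncard_prod, Set.ncard_univ, hcard]

-- Each class `q` yields a point `x q` of `X_f`, namely `f⁻¹ w` mod 1 for a bounded representative
-- `w`. Approximate `x q` by a member of a maximal separated set, and record that member together
-- with the integral error `k`. The error vanishes off the boundary, so the class is recovered from
-- at most `N` members and a lattice point on the boundary.
set_option maxHeartbeats 1000000 in
theorem natAbs_det_le {F : Finset Γ} {c C ε : ℝ} (hc : 0 < c) (hε : 0 < ε)
    (hL : 0 < l1Norm f) (hε' : ε ≤ 1 / (2 * l1Norm f)) (hC : 0 ≤ C)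
    (hq : ∀ x : F → ℝ, c * ∑ t, x t ^ 2 ≤ ∑ t, x t * (realMat f F).mulVec x t)
    (hsol : ∀ w : F → ℝ, ∃ v : Γ → ℝ,
      (∀ t, conv f v t = if h : t ∈ F then w ⟨t, h⟩ else 0) ∧
      ∑ t : F, v t ^ 2 ≤ C * ∑ t : F, w t ^ 2)
    {N : ℕ} (hN : sepNumber (algAction f) (algPseudoDist f) F ε = N) :
    (compMat f F).det.natAbs ≤ N * (latticeBall (bdry f F)
      ((2 * l1Norm f + 16 * C * l1Norm f ^ 3) * F.card)).ncard := by
  have hdet := compMat_det_ne_zero hc hq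
  obtain ⟨-, hcard, hfinQ⟩ := cokerCard_eq f F hdet
  set Q := (F → ℤ) ⧸ LinearMap.range (compression f F)
  set L := l1Norm f
  set B := latticeBall (bdry f F) ((2 * L + 16 * C * L ^ 3) * F.card)
  have hrep : ∀ q : Q, ∃ w : F → ℤ, Submodule.Quotient.mk w = q ∧ ∀ t, |(w t : ℝ)| ≤ L := by
    intro q
    obtain ⟨w, rfl⟩ := Submodule.Quotient.mk_surjective _ q
    obtain ⟨x, hx⟩ := exists_realMat_mulVec_eq hdet (fun t => (w t : ℝ))
    set z : F → ℤ := fun t => ⌊x t⌋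
    -- Removing the integer part of `M⁻¹ w` leaves `M` applied to a vector in `[0,1)^F`, whose
    -- entries are at most `‖f‖₁`.
    refine ⟨w - (compMat f F).mulVec z, (mk_eq_mk_iff _ _).2 ⟨-z, ?_⟩, fun t => ?_⟩
    · rw [Matrix.mulVec_neg]; abel
    · have h : (((w - (compMat f F).mulVec z) t : ℤ) : ℝ)
          = (realMat f F).mulVec (fun t => Int.fract (x t)) t := by
        have : (fun t => Int.fract (x t)) = x - fun t => (z t : ℝ) := rfl
        rw [this, Matrix.mulVec_sub, hx, realMat_mulVec_intCast]
        simp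
      rw [h]
      refine (abs_mulVec_le (r := 1) (fun t => ?_) t).trans (by rw [mul_one])
      rw [abs_of_nonneg (Int.fract_nonneg _)]
      exact (Int.fract_lt_one _).le
  choose w hwq hwL using hrep
  choose v hv hvC using fun q : Q => hsol (fun t => (w q t : ℝ))
  have hvC' : ∀ q, ∑ t : F, v q t ^ 2 ≤ C * L ^ 2 * F.card := fun q => by
    refine (hvC q).trans ?_
    have : ∑ t : F, (w q t : ℝ) ^ 2 ≤ ∑ _t : F, L ^ 2 := Finset.sum_le_sum fun t _ => by
      rw [← sq_abs]
      exact pow_le_pow_left₀ (abs_nonneg _) (hwL q t) 2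
    rw [Finset.sum_const, Finset.card_univ, Fintype.card_coe, nsmul_eq_mul] at this
    nlinarith
  set x : Q → algX f := fun q => ⟨fun t => (v q t : UnitAddCircle),
    (coe_mem_algX_iff _).2 fun t => by
    rw [hv]
    split_ifs
    · exact ⟨_, rfl⟩
    · exact ⟨0, by simp⟩⟩ with hx
  obtain ⟨E, hEx, hEsep, hEmax⟩ := exists_maximal_sep (F := F) hε.le (Set.range x)
  choose e heE hed using fun q => hEmax (x q) ⟨q, rfl⟩
  -- The class `p` depends only on the member of `E`, not on the `q` approximated by it; the
  -- injectivity below rests on this.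
  choose p hp using fun y : E => hEx y.2
  set z : Q → F → ℤ := fun q t => round (v q t - v (p ⟨e q, heE q⟩) t) with hz
  set k : Q → F → ℤ := fun q => w q - w (p ⟨e q, heE q⟩) - (compMat f F).mulVec (z q) with hk
  have hkM : ∀ q t, (k q t : ℝ) = w q t - w (p ⟨e q, heE q⟩) t
      - (realMat f F).mulVec (fun t => (z q t : ℝ)) t := fun q t => by
    rw [realMat_mulVec_intCast]; simp [hk]
  have hint : ∀ q (t : F), (t : Γ) ∉ bdry f F → k q t = 0 := by
    intro q t ht
    set p' := p ⟨e q, heE q⟩ with hp'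
    set r : Γ → ℝ := fun u => v q u - v p' u - round (v q u - v p' u) with hr
    have hrle : ∀ u ∈ F, |r u| ≤ ε := fun u hu => by
      have h1 := hed q u hu
      have h2 : e q = x p' := (hp ⟨e q, heE q⟩).symm
      rw [h2] at h1
      change dist (v q u : UnitAddCircle) (v p' u) ≤ ε at h1
      rwa [dist_coe_eq] at h1
    have h1 : (k q t : ℝ) = (realMat f F).mulVec (fun u => r u) t := by
      have : (fun u : F => r u) = (fun u : F => v q u) - (fun u : F => v p' u)
        - fun u => (z q u : ℝ) := rfl
      rw [this, Matrix.mulVec_sub, Matrix.mulVec_sub, hkM, Pi.sub_apply, Pi.sub_apply,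
        ← conv_eq_mulVec (v q) t.2 ht, ← conv_eq_mulVec (v p') t.2 ht, hv, hv, dif_pos t.2,
        dif_pos t.2]
    have h2 : |(k q t : ℝ)| ≤ L * ε := by
      rw [h1]
      exact abs_mulVec_le (fun u => hrle u u.2) t
    -- The only use of the upper bound on `ε`: an integer of absolute value at most 1/2 is zero.
    have h3 : L * ε ≤ 1 / 2 := by
      calc L * ε ≤ L * (1 / (2 * L)) := by gcongr
        _ = 1 / 2 := by field_simp
    have h4 : |(k q t : ℝ)| < 1 := by linarith
    exact Int.abs_lt_one_iff.1 (by exact_mod_cast h4)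
  have hball : ∀ q, (fun t : bdry f F => k q ⟨t, (Finset.mem_filter.1 t.2).1⟩) ∈ B := by
    intro q
    set p' := p ⟨e q, heE q⟩ with hp'
    -- `4(a-b)² ≤ 8(a²+b²)`, and each of the two sums of squares is at most `C L² |F|`; hence 16.
    have hz1 : ∑ t, |(z q t : ℝ)| ≤ 16 * C * L ^ 2 * F.card := by
      calc _ ≤ ∑ t : F, 8 * (v q t ^ 2 + v p' t ^ 2) := Finset.sum_le_sum fun t _ => by
            refine (abs_round_le_four_mul_sq _).trans ?_
            nlinarith [sq_nonneg (v q t + v p' t)]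
        _ ≤ _ := by
            rw [← Finset.mul_sum, Finset.sum_add_distrib]
            linarith [hvC' q, hvC' p']
    calc ∑ t : bdry f F, |(k q ⟨t, (Finset.mem_filter.1 t.2).1⟩ : ℝ)|
        ≤ ∑ t : F, |(k q t : ℝ)| := by
          rw [← Finset.sum_image (f := fun t : F => |(k q t : ℝ)|) (s := Finset.univ)
            (g := fun t : bdry f F => (⟨t, (Finset.mem_filter.1 t.2).1⟩ : F))]
          · exact Finset.sum_le_sum_of_subset_of_nonneg (Finset.subset_univ _)
              fun _ _ _ => abs_nonneg _
          · intro a _ b _ hab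
            exact Subtype.ext (congrArg (fun t : F => (t : Γ)) hab)
      _ ≤ ∑ t : F, (2 * L + |(realMat f F).mulVec (fun t => (z q t : ℝ)) t|) := by
          refine Finset.sum_le_sum fun t _ => ?_
          rw [hkM]
          have h1 := hwL q t
          have h2 := hwL p' t
          have h3 := abs_sub ((w q t : ℝ) - w p' t) ((realMat f F).mulVec (fun t => (z q t : ℝ)) t)
          have h4 := abs_sub (w q t : ℝ) (w p' t)
          linarith
      _ ≤ 2 * L * F.card + L * (16 * C * L ^ 2 * F.card) := by
          rw [Finset.sum_add_distrib, Finset.sum_const, Finset.card_univ, Fintype.card_coe,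
            nsmul_eq_mul]
          have := sum_abs_mulVec_le (f := f) (fun t => (z q t : ℝ))
          have h5 := mul_le_mul_of_nonneg_left hz1 hL.le
          linarith
      _ = _ := by ring
  have hinj : Function.Injective fun q : Q =>
      ((e q, fun t : bdry f F => k q ⟨t, (Finset.mem_filter.1 t.2).1⟩) :
        algX f × (bdry f F → ℤ)) := by
    intro a b hab
    rw [Prod.mk.injEq] at hab
    obtain ⟨h1, h2⟩ := hab
    have hpp : p ⟨e a, heE a⟩ = p ⟨e b, heE b⟩ := by congr 2
    have hkk : k a = k b := funext fun t => by
      by_cases ht : (t : Γ) ∈ bdry f F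
      · exact congrFun h2 ⟨t, ht⟩
      · rw [hint a t ht, hint b t ht]
    rw [← hwq a, ← hwq b, mk_eq_mk_iff]
    -- Equal errors relative to the same `p` leave `w a - w b = M (z a - z b)`.
    refine ⟨z a - z b, ?_⟩
    simp only [hk] at hkk
    rw [hpp] at hkk
    rw [Matrix.mulVec_sub]
    have := sub_eq_zero.2 hkk
    rw [← sub_eq_zero, ← neg_eq_zero, ← this]
    abel
  have hB := finite_latticeBall (bdry f F) ((2 * L + 16 * C * L ^ 3) * F.card)
  have hEN : E.encard ≤ N := (encard_le_sepNumber hEsep).trans hN.le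
  have hEfin : E.Finite := Set.finite_of_encard_le_coe hEN
  have hle := Set.ncard_le_ncard_of_injOn (s := (Set.univ : Set Q)) (t := E ×ˢ B) _
    (fun q _ => ⟨heE q, hball q⟩) hinj.injOn (hEfin.prod hB)
  rw [Set.ncard_univ, hcard, Set.ncard_prod] at hle
  refine hle.trans (Nat.mul_le_mul_right _ ?_)
  rw [← hEfin.cast_ncard_eq] at hEN
  exact_mod_cast hEN

end Counting

/-! ### Removal of the error terms in the limit. -/

theorem tendsto_latticeGrowth : Tendsto latticeGrowth atTop (𝓝 1) := by
  have h : Tendsto (fun s : ℝ => Real.exp (-s)) atTop (𝓝 0) := Real.tendsto_exp_neg_atTop_nhds_zero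
  have := (h.const_add 1).div (h.const_sub 1) (by norm_num)
  rw [add_zero, sub_zero, div_one] at this
  exact this

/-- Since `b → 0` for each fixed `s`, the upper estimate for `a` leaves `log (latticeGrowth s)`,
which vanishes as `s → ∞`. The lower estimate leaves `s C₂`, which is made small by taking `s` near
0. -/
theorem tendsto_of_growth_bounds {α : Type*} {l : Filter α} {a D b : α → ℝ} {τ C₁ C₂ : ℝ}
    (hD : Tendsto D l (𝓝 τ)) (hb : Tendsto b l (𝓝 0))
    (h₁ : ∀ s > 0, ∀ᶠ F in l, a F ≤ D F + s * C₁ * b F + Real.log (latticeGrowth s))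
    (h₂ : ∀ s > 0, ∀ᶠ F in l, D F ≤ a F + s * C₂ + b F * Real.log (latticeGrowth s)) :
    Tendsto a l (𝓝 τ) := by
  rw [tendsto_order]
  constructor
  · intro r hr
    obtain ⟨s, hs, hsC⟩ : ∃ s > 0, s * C₂ < (τ - r) := by
      refine ⟨(τ - r) / (|C₂| + 1), div_pos (by linarith) (by positivity), ?_⟩
      rw [div_mul_eq_mul_div, div_lt_iff₀ (by positivity)]
      have := le_abs_self C₂
      nlinarith
    have hlim : Tendsto (fun F => D F - s * C₂ - b F * Real.log (latticeGrowth s)) l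
        (𝓝 (τ - s * C₂ - 0 * Real.log (latticeGrowth s))) :=
      (hD.sub_const _).sub (hb.mul_const _)
    filter_upwards [h₂ s hs, hlim.eventually (lt_mem_nhds (show r < _ by linarith))] with F h h'
    linarith
  · intro r hr
    have hlog : Tendsto (fun s => Real.log (latticeGrowth s)) atTop (𝓝 0) := by
      have := (Real.continuousAt_log (one_ne_zero)).tendsto.comp tendsto_latticeGrowth
      rw [Real.log_one] at this
      exact this
    obtain ⟨s, hsl, hs⟩ := ((hlog.eventually (gt_mem_nhds (show 0 < r - τ by linarith))).and
      (eventually_gt_atTop 0)).exists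
    have hlim : Tendsto (fun F => D F + s * C₁ * b F + Real.log (latticeGrowth s)) l
        (𝓝 (τ + s * C₁ * 0 + Real.log (latticeGrowth s))) :=
      (hD.add (hb.const_mul _)).add_const _
    filter_upwards [h₁ s hs, hlim.eventually (gt_mem_nhds (show _ < r by linarith))] with F h h'
    linarith

theorem card_symmDiff_le {α : Type*} (A B C : Finset α) :
    (A ∆ C).card ≤ (A ∆ B).card + (B ∆ C).card :=
  (Finset.card_le_card (symmDiff_triangle A B C)).trans (Finset.card_union_le _ _)

/-! ### Boundaries and products of almost invariant sets. -/

section Invariance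

variable {Γ : Type*} [Group Γ]

theorem eventually_nonempty_invarianceFilter :
    ∀ᶠ F in invarianceFilter Γ, F.Nonempty := by
  have h : invarianceFilter Γ ≤ 𝓟 {F : Finset Γ | F.Nonempty ∧ invarianceDefect {1} F ≤ 1} :=
    iInf₂_le_of_le {1} (Finset.singleton_nonempty 1) (iInf₂_le_of_le 1 one_pos le_rfl)
  exact Eventually.mono (h (mem_principal_self _)) fun F hF => hF.1

theorem invarianceDefect_nonneg (K F : Finset Γ) : 0 ≤ invarianceDefect K F := by
  unfold invarianceDefect; positivity

theorem tendsto_invarianceDefect {K : Finset Γ} (hK : K.Nonempty) :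
    Tendsto (invarianceDefect K) (invarianceFilter Γ) (𝓝 0) := by
  rw [tendsto_order]
  refine ⟨fun r hr => Eventually.of_forall fun F => hr.trans_le (invarianceDefect_nonneg K F),
    fun r hr => ?_⟩
  have h : invarianceFilter Γ ≤ 𝓟 {F : Finset Γ | F.Nonempty ∧ invarianceDefect K F ≤ r / 2} :=
    iInf₂_le_of_le K hK (iInf₂_le_of_le (r / 2) (by positivity) le_rfl)
  exact Eventually.mono (h (mem_principal_self _)) fun F hF => hF.2.trans_lt (by linarith)

theorem tendsto_invarianceFilter {α : Type*} {l : Filter α} {u : α → Finset Γ}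
    (hne : ∀ᶠ a in l, (u a).Nonempty)
    (h : ∀ K : Finset Γ, K.Nonempty → Tendsto (fun a => invarianceDefect K (u a)) l (𝓝 0)) :
    Tendsto u l (invarianceFilter Γ) := by
  simp only [invarianceFilter, tendsto_iInf, tendsto_principal]
  intro K hK δ hδ
  filter_upwards [hne, (h K hK).eventually (ge_mem_nhds hδ)] with a h1 h2
  exact ⟨h1, h2⟩

theorem IsFolnerNet.tendsto_invarianceFilter {J : Type*} [Preorder J] {F : J → Finset Γ}
    (hF : IsFolnerNet F) : Tendsto F atTop (invarianceFilter Γ) :=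
  _root_.tendsto_invarianceFilter (Eventually.of_forall hF.nonempty) hF.tendsto

/-- The points of `F` that some element of `K` moves out of `F`. -/
def outer (K F : Finset Γ) : Finset Γ := F.filter fun t => ∃ s ∈ K, s * t ∉ F

/-- For each `s ∈ K`, translation by `s` injects the points of `F` that it moves out of `F` into `KF
\ F`. -/
theorem card_outer_le (K F : Finset Γ) :
    ((outer K F).card : ℝ) ≤ K.card * ((K * F) ∆ F).card := by
  have hsub : outer K F ⊆ K.biUnion fun s => F.filter fun t => s * t ∉ F := fun t ht => by
    obtain ⟨ht, s, hs, hst⟩ := Finset.mem_filter.1 ht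
    exact Finset.mem_biUnion.2 ⟨s, hs, Finset.mem_filter.2 ⟨ht, hst⟩⟩
  have h : (outer K F).card ≤ K.card * ((K * F) ∆ F).card := by
    refine (Finset.card_le_card hsub).trans (Finset.card_biUnion_le_card_mul _ _ _ fun s hs => ?_)
    refine Finset.card_le_card_of_injOn (fun t => s * t) (fun t ht => ?_)
      (mul_right_injective s).injOn
    obtain ⟨ht, hst⟩ := Finset.mem_filter.1 ht
    exact Finset.mem_symmDiff.2 (Or.inl ⟨Finset.mul_mem_mul hs ht, hst⟩)
  exact_mod_cast h

theorem tendsto_card_outer_div (K : Finset Γ) :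
    Tendsto (fun F => ((outer K F).card : ℝ) / F.card) (invarianceFilter Γ) (𝓝 0) := by
  rcases K.eq_empty_or_nonempty with rfl | hK
  · simpa [outer] using tendsto_const_nhds
  have := (tendsto_invarianceDefect hK).const_mul (K.card : ℝ)
  rw [mul_zero] at this
  refine squeeze_zero (fun F => by positivity) (fun F => ?_) this
  rw [invarianceDefect, ← mul_div_assoc]
  gcongr
  exact card_outer_le K F

theorem bdry_eq_outer (f : MonoidAlgebra ℤ Γ) (F : Finset Γ) :
    bdry f F = outer (f.coeff.support.image fun s => s⁻¹) F := by
  ext t; simp [bdry, outer]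

/-- Both `K'KF` and `KF` are close to `F`, hence to each other, and `1 ∈ K` gives `|F| ≤ |KF|`.
Needed because open covers of `X_f` read coordinates in `KF`. -/
theorem tendsto_mul_invarianceFilter {K : Finset Γ} (hK : (1 : Γ) ∈ K) :
    Tendsto (fun F => K * F) (invarianceFilter Γ) (invarianceFilter Γ) := by
  have hKne : K.Nonempty := ⟨1, hK⟩
  refine tendsto_invarianceFilter ?_ fun K' hK' => ?_
  · exact eventually_nonempty_invarianceFilter.mono fun F hF => hKne.mul hF
  have hlim := (tendsto_invarianceDefect (hK'.mul hKne)).add (tendsto_invarianceDefect hKne)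
  rw [add_zero] at hlim
  refine squeeze_zero' (Eventually.of_forall fun F => invarianceDefect_nonneg _ _) ?_ hlim
  filter_upwards [eventually_nonempty_invarianceFilter] with F hF
  have hF0 : (0 : ℝ) < F.card := by exact_mod_cast hF.card_pos
  have hle : F.card ≤ (K * F).card := Finset.card_le_card fun t ht => by
    simpa using Finset.mul_mem_mul hK ht
  rw [invarianceDefect, invarianceDefect, invarianceDefect, ← add_div]
  have h1 := card_symmDiff_le (K' * (K * F)) F (K * F)
  rw [symmDiff_comm F, ← mul_assoc] at h1
  have h2 : (((K' * K * F) ∆ (K * F)).card : ℝ)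
      ≤ ((K' * K * F) ∆ F).card + ((K * F) ∆ F).card := by exact_mod_cast h1
  rw [← mul_assoc]
  gcongr

theorem tendsto_card_mul_div {K : Finset Γ} (hK : (1 : Γ) ∈ K) :
    Tendsto (fun F => ((K * F).card : ℝ) / F.card) (invarianceFilter Γ) (𝓝 1) := by
  have hlim := (tendsto_invarianceDefect ⟨1, hK⟩).const_add (1 : ℝ)
  rw [add_zero] at hlim
  refine tendsto_of_tendsto_of_tendsto_of_le_of_le' tendsto_const_nhds hlim ?_ ?_
  · filter_upwards [eventually_nonempty_invarianceFilter] with F hF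
    have hF0 : (0 : ℝ) < F.card := by exact_mod_cast hF.card_pos
    rw [le_div_iff₀ hF0, one_mul]
    exact_mod_cast Finset.card_le_card fun t ht => by simpa using Finset.mul_mem_mul hK ht
  · filter_upwards [eventually_nonempty_invarianceFilter] with F hF
    have hF0 : (0 : ℝ) < F.card := by exact_mod_cast hF.card_pos
    rw [invarianceDefect, div_le_iff₀ hF0, add_mul, one_mul, div_mul_cancel₀ _ hF0.ne']
    have : (K * F).card ≤ F.card + ((K * F) ∆ F).card := by
      refine (Finset.card_le_card fun t ht => ?_).trans (Finset.card_union_le _ _)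
      by_cases h : t ∈ F
      · exact Finset.mem_union_left _ h
      · exact Finset.mem_union_right _ (Finset.mem_symmDiff.2 (Or.inl ⟨ht, h⟩))
    exact_mod_cast this

end Invariance

/-! ### Spectral bounds for symmetric matrices and self-adjoint operators. -/

theorem Matrix.IsHermitian.trace_pow_eq_sum {n : Type*} [Fintype n] [DecidableEq n]
    {M : Matrix n n ℝ}
    (hM : M.IsHermitian) (j : ℕ) : (M ^ j).trace = ∑ i, hM.eigenvalues i ^ j := by
  conv_lhs => rw [hM.spectral_theorem, ← map_pow, Unitary.conjStarAlgAut_apply,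
    Matrix.trace_mul_comm, ← mul_assoc]
  simp [Matrix.diagonal_pow, Matrix.trace_diagonal]

theorem Matrix.IsHermitian.eigenvalues_mem_Icc {n : Type*} [Fintype n] [DecidableEq n]
    {M : Matrix n n ℝ}
    (hM : M.IsHermitian) {c R : ℝ} (h₁ : ∀ x : n → ℝ, c * ∑ t, x t ^ 2 ≤ ∑ t, x t * M.mulVec x t)
    (h₂ : ∀ x : n → ℝ, ∑ t, x t * M.mulVec x t ≤ R * ∑ t, x t ^ 2) (i : n) :
    hM.eigenvalues i ∈ Set.Icc c R := by
  have hv := hM.mulVec_eigenvectorBasis i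
  set v : n → ℝ := ⇑(hM.eigenvectorBasis i) with hvdef
  have hnorm : ∑ t, v t ^ 2 = 1 := by
    have h := hM.eigenvectorBasis.orthonormal.1 i
    rw [EuclideanSpace.norm_eq, Real.sqrt_eq_one] at h
    simpa using h
  have hM1 : ∑ t, v t * M.mulVec v t = hM.eigenvalues i := by
    rw [hv]
    have : ∀ t, v t * (hM.eigenvalues i • v) t = hM.eigenvalues i * v t ^ 2 := fun t => by
      simp only [Pi.smul_apply, smul_eq_mul]; ring
    simp only [this]
    rw [← Finset.mul_sum, hnorm, mul_one]
  have a := h₁ v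
  have b := h₂ v
  rw [hM1, hnorm, mul_one] at a b
  exact ⟨a, b⟩

section Hilbert

variable {H : Type*} [NormedAddCommGroup H] [InnerProductSpace ℂ H] [CompleteSpace H]

theorem IsSelfAdjoint.spectrum_subset_Icc {T : H →L[ℂ] H} (hsa : IsSelfAdjoint T) {c : ℝ}
    (hc : ∀ x : H, c * ‖x‖ ^ 2 ≤ (inner ℂ x (T x)).re) : spectrum ℝ T ⊆ Set.Icc c ‖T‖ := by
  intro r hr
  rcases subsingleton_or_nontrivial H with hH | hH
  · exact absurd hr (by rw [spectrum.of_subsingleton]; simp)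
  refine ⟨?_, (le_abs_self r).trans (spectrum.norm_le_norm_of_mem hr)⟩
  have hle : algebraMap ℝ (H →L[ℂ] H) c ≤ T := by
    rw [ContinuousLinearMap.le_def, ContinuousLinearMap.isPositive_iff_complex]
    intro x
    have hreal : ((inner ℂ (T x) x).re : ℂ) = inner ℂ (T x) x :=
      hsa.isSymmetric.coe_reApplyInnerSelf_apply x
    have h1 : inner ℂ ((T - algebraMap ℝ (H →L[ℂ] H) c) x) x
        = (((inner ℂ (T x) x).re - c * ‖x‖ ^ 2 : ℝ) : ℂ) := by
      have h2 : (T - algebraMap ℝ (H →L[ℂ] H) c) x = T x - (c : ℂ) • x := by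
        rw [Algebra.algebraMap_eq_smul_one]; rfl
      rw [h2, inner_sub_left, inner_smul_left, inner_self_eq_norm_sq_to_K, Complex.ofReal_sub,
        hreal]
      simp
    rw [h1]
    have h3 := hc x
    rw [← inner_conj_symm, Complex.conj_re] at h3
    exact ⟨rfl, sub_nonneg.2 h3⟩
  exact (algebraMap_le_iff_le_spectrum (a := T)).1 hle r hr

theorem IsSelfAdjoint.norm_log_sub_aeval_le {T : H →L[ℂ] H} (hsa : IsSelfAdjoint T) {c η : ℝ}
    (hc0 : 0 < c) (hη : 0 ≤ η) (hc : ∀ x : H, c * ‖x‖ ^ 2 ≤ (inner ℂ x (T x)).re)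
    {p : Polynomial ℝ} (hp : ∀ x ∈ Set.Icc c ‖T‖, |p.eval x - Real.log x| ≤ η) :
    ‖CFC.log T - Polynomial.aeval T p‖ ≤ η := by
  have hspec := hsa.spectrum_subset_Icc hc
  rw [CFC.log, ← cfc_polynomial p T hsa, ← cfc_sub (a := T) Real.log p.eval
    (Real.continuousOn_log.mono fun x hx => (hc0.trans_le (hspec hx).1).ne')
    p.continuous.continuousOn]
  refine norm_cfc_le hη fun x hx => ?_
  rw [Real.norm_eq_abs, abs_sub_comm]
  exact hp x (hspec hx)

/-- For self-adjoint `f` one has `f* f = f²`, so this cancels the factor 1/2 in `fkDet`. -/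
theorem IsSelfAdjoint.log_sq {T : H →L[ℂ] H} (hsa : IsSelfAdjoint T) {c : ℝ}
    (hc0 : 0 < c) (hc : ∀ x : H, c * ‖x‖ ^ 2 ≤ (inner ℂ x (T x)).re) :
    CFC.log (T ^ 2) = CFC.log T + CFC.log T := by
  rw [CFC.log_pow 2 T (fun x hx => (hc0.trans_le (hsa.spectrum_subset_Icc hc hx).1).ne') hsa,
    two_nsmul]

end Hilbert

/-! ### Convergence of normalised traces and of `log |det f_F| / |F|`. -/

section Trace

variable {Γ : Type*} [Group Γ] {f : MonoidAlgebra ℤ Γ}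

theorem coeff_mul_eq_sum_right (f g : MonoidAlgebra ℤ Γ) {U : Finset Γ}
    (hU : g.coeff.support ⊆ U) (t : Γ) :
    (f * g).coeff t = ∑ u ∈ U, f.coeff (t * u⁻¹) * g.coeff u := by
  conv_lhs => rw [← MonoidAlgebra.sum_coeff_single g]
  rw [Finsupp.sum, Finset.mul_sum, MonoidAlgebra.coeff_sum, Finset.sum_apply']
  rw [← Finset.sum_subset hU fun u _ hu => by rw [Finsupp.notMem_support_iff.1 hu, mul_zero]]
  simp

theorem coeff_mul_eq_sum_left (f g : MonoidAlgebra ℤ Γ) (t : Γ) :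
    (f * g).coeff t = ∑ s ∈ f.coeff.support, f.coeff s * g.coeff (s⁻¹ * t) := by
  conv_lhs => rw [← MonoidAlgebra.sum_coeff_single f]
  rw [Finsupp.sum, Finset.sum_mul, MonoidAlgebra.coeff_sum, Finset.sum_apply']
  simp

theorem leftMul_pow_delta_apply (j : ℕ) (t : Γ) :
    (leftMul f ^ j) (delta 1) t = (((f ^ j).coeff t : ℤ) : ℂ) := by
  induction j generalizing t with
  | zero =>
    rw [pow_zero, pow_zero, MonoidAlgebra.one_def, MonoidAlgebra.coeff_single,
      one_apply_eq_self, delta_apply, Finsupp.single_apply]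
    simp [eq_comm]
  | succ j ih =>
    have h : (leftMul f ^ (j + 1)) (delta 1) = leftMul f ((leftMul f ^ j) (delta 1)) := by
      rw [pow_succ']; rfl
    rw [h, pow_succ', leftMul_apply, coeff_mul_eq_sum_left]
    rw [Int.cast_sum]
    exact Finset.sum_congr rfl fun s _ => by rw [ih, Int.cast_mul]

/-- The union of the supports of `f ^ i`, `i ≤ j`. -/
def powSupport (f : MonoidAlgebra ℤ Γ) (j : ℕ) : Finset Γ :=
  (Finset.range (j + 1)).biUnion fun i => (f ^ i).coeff.support

theorem support_pow_subset_powSupport {i j : ℕ} (hij : i ≤ j) :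
    (f ^ i).coeff.support ⊆ powSupport f j := fun _ ht =>
  Finset.mem_biUnion.2 ⟨i, Finset.mem_range.2 (by omega), ht⟩

/-- For such `u` the supports of all `f ^ i`, translated by `u`, stay in `F`. The intermediate
vectors `f ^ i δ_u` are never truncated, which is why all powers up to `J` enter the hypothesis. -/
theorem realMat_pow_apply {F : Finset Γ} {J : ℕ} {u : F} (hu : (u : Γ) ∉ outer (powSupport f J) F)
    {j : ℕ} (hj : j ≤ J) (t : F) :
    (realMat f F ^ j) t u = ((f ^ j).coeff ((t : Γ) * (u : Γ)⁻¹) : ℝ) := by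
  induction j generalizing t with
  | zero =>
    rw [pow_zero, pow_zero, MonoidAlgebra.one_def, MonoidAlgebra.coeff_single, Matrix.one_apply,
      Finsupp.single_apply]
    by_cases h : t = u
    · simp [h]
    · have : ¬ (1 : Γ) = (t : Γ) * (u : Γ)⁻¹ := fun h' => h (Subtype.ext (by
        rw [eq_comm, mul_inv_eq_one] at h'; exact h'))
      simp [h, this]
  | succ j ih =>
    have hsub : (f ^ j).coeff.support ⊆ F.image fun v => v * (u : Γ)⁻¹ := fun s hs => by
      by_contra hcon
      refine hu (Finset.mem_filter.2 ⟨u.2, s, support_pow_subset_powSupport (by omega) hs,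
        fun hmem => hcon (Finset.mem_image.2 ⟨_, hmem, by simp⟩)⟩)
    rw [pow_succ', pow_succ', Matrix.mul_apply, coeff_mul_eq_sum_right f (f ^ j) hsub,
      Finset.sum_image (fun a _ b _ h => mul_right_cancel h), ← Finset.sum_coe_sort F]
    push_cast
    refine Finset.sum_congr rfl fun v _ => ?_
    rw [ih (by omega)]
    simp [realMat]

theorem abs_realMat_pow_apply_le {F : Finset Γ} (j : ℕ) (t u : F) :
    |(realMat f F ^ j) t u| ≤ l1Norm f ^ j := by
  induction j generalizing t with
  | zero =>
    rw [pow_zero, pow_zero, Matrix.one_apply]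
    split_ifs <;> simp
  | succ j ih =>
    have h : (realMat f F ^ (j + 1)) t u
        = (realMat f F).mulVec (fun v => (realMat f F ^ j) v u) t := by
      rw [pow_succ', Matrix.mul_apply]; rfl
    rw [h, pow_succ']
    exact abs_mulVec_le (fun v => ih v) t

/-- Diagonal entries equal `(f ^ j)_e` except on a set of vanishing density, where they are bounded
by `‖f‖₁ ^ j`. -/
theorem tendsto_trace_pow (j : ℕ) :
    Tendsto (fun F => (realMat f F ^ j).trace / F.card) (invarianceFilter Γ)
      (𝓝 (((f ^ j).coeff 1 : ℤ) : ℝ)) := by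
  rw [tendsto_iff_dist_tendsto_zero]
  set a : ℝ := (((f ^ j).coeff 1 : ℤ) : ℝ)
  have hlim := (tendsto_card_outer_div (powSupport f j)).const_mul (l1Norm f ^ j + |a|)
  rw [mul_zero] at hlim
  refine squeeze_zero' (Eventually.of_forall fun F => dist_nonneg) ?_ hlim
  filter_upwards [eventually_nonempty_invarianceFilter] with F hF
  have hF0 : (0 : ℝ) < F.card := by exact_mod_cast hF.card_pos
  have h1 : (realMat f F ^ j).trace / F.card - a
      = (∑ u : F, ((realMat f F ^ j) u u - a)) / F.card := by
    rw [Finset.sum_sub_distrib, Finset.sum_const, Finset.card_univ, Fintype.card_coe,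
      nsmul_eq_mul, sub_div, mul_div_cancel_left₀ _ hF0.ne']
    rfl
  have h2 : ∀ u : F, |(realMat f F ^ j) u u - a|
      ≤ if (u : Γ) ∈ outer (powSupport f j) F then l1Norm f ^ j + |a| else 0 := fun u => by
    split_ifs with h
    · exact (abs_sub _ _).trans (add_le_add (abs_realMat_pow_apply_le j u u) le_rfl)
    · rw [realMat_pow_apply h le_rfl]
      simp [a]
  rw [Real.dist_eq, h1, abs_div, abs_of_pos hF0, ← mul_div_assoc]
  gcongr
  refine (Finset.abs_sum_le_sum_abs _ _).trans ((Finset.sum_le_sum fun u _ => h2 u).trans ?_)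
  rw [Finset.sum_coe_sort F (fun t => if t ∈ outer (powSupport f j) F
    then l1Norm f ^ j + |a| else 0), ← Finset.sum_filter, Finset.sum_const, nsmul_eq_mul, mul_comm]
  have h0 : 0 ≤ l1Norm f := Finset.sum_nonneg fun _ _ => abs_nonneg _
  gcongr
  exact fun t ht => (Finset.mem_filter.1 ht).2

theorem re_vnTrace_aeval (p : Polynomial ℝ) :
    (vnTrace (Polynomial.aeval (leftMul f) p)).re
      = ∑ j ∈ Finset.range (p.natDegree + 1), p.coeff j * ((f ^ j).coeff 1 : ℤ) := by
  have h : vnTrace (Polynomial.aeval (leftMul f) p)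
      = (Polynomial.aeval (leftMul f) p) (delta 1) 1 := inner_delta_left 1 _
  rw [h, Polynomial.aeval_eq_sum_range, _root_.sum_apply, lp.coeFn_sum, Finset.sum_apply,
    Complex.re_sum]
  refine Finset.sum_congr rfl fun j _ => ?_
  have : (p.coeff j • leftMul f ^ j) (delta 1) 1 = (p.coeff j : ℂ) * (leftMul f ^ j) (delta 1) 1 :=
    rfl
  rw [this, leftMul_pow_delta_apply, Complex.re_ofReal_mul, Complex.intCast_re]

theorem tendsto_sum_eval_eigenvalues (hM : ∀ F, (realMat f F).IsHermitian) (p : Polynomial ℝ) :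
    Tendsto (fun F => (∑ i, p.eval ((hM F).eigenvalues i)) / F.card) (invarianceFilter Γ)
      (𝓝 (vnTrace (Polynomial.aeval (leftMul f) p)).re) := by
  rw [re_vnTrace_aeval]
  have h : ∀ F : Finset Γ, (∑ i, p.eval ((hM F).eigenvalues i)) / F.card
      = ∑ j ∈ Finset.range (p.natDegree + 1),
        p.coeff j * ((realMat f F ^ j).trace / F.card) := fun F => by
    simp only [Polynomial.eval_eq_sum_range]
    rw [Finset.sum_comm, Finset.sum_div]
    refine Finset.sum_congr rfl fun j _ => ?_
    rw [← Finset.mul_sum, mul_div_assoc, (hM F).trace_pow_eq_sum]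
  simp only [h]
  exact tendsto_finsetSum _ fun j _ => (tendsto_trace_pow j).const_mul _

theorem abs_re_vnTrace_le (T : EllTwo Γ →L[ℂ] EllTwo Γ) : |(vnTrace T).re| ≤ ‖T‖ := by
  have hd : ‖(delta 1 : EllTwo Γ)‖ = 1 := by
    rw [delta, lp.norm_single (by norm_num)]; simp
  refine (Complex.abs_re_le_norm _).trans ((norm_inner_le_norm _ _).trans ?_)
  have := T.le_opNorm (delta 1)
  change ‖(delta 1 : EllTwo Γ)‖ * ‖T (delta 1)‖ ≤ _
  rw [hd] at this ⊢
  linarith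

theorem vnTrace_sub (S T : EllTwo Γ →L[ℂ] EllTwo Γ) : vnTrace (S - T) = vnTrace S - vnTrace T :=
  inner_sub_right _ _ _

/-- One polynomial approximates `log` on `[c, ‖f‖]`, which contains the spectra of `f` and of every
`f_F`. The approximation error is therefore uniform in `F`, and only traces of polynomials remain.
-/
theorem tendsto_log_det {c : ℝ} (hc : 0 < c) (hsa : IsSelfAdjoint (leftMul f))
    (hM : ∀ F, (realMat f F).IsHermitian)
    (hq : ∀ (F : Finset Γ) (x : F → ℝ),
      c * ∑ t, x t ^ 2 ≤ ∑ t, x t * (realMat f F).mulVec x t)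
    (hA : ∀ x : EllTwo Γ, c * ‖x‖ ^ 2 ≤ (inner ℂ x (leftMul f x)).re) :
    Tendsto (fun F => Real.log (compMat f F).det.natAbs / F.card) (invarianceFilter Γ)
      (𝓝 (vnTrace (CFC.log (leftMul f))).re) := by
  have hlogdet : ∀ F : Finset Γ, Real.log (compMat f F).det.natAbs
      = ∑ i, Real.log ((hM F).eigenvalues i) := fun F => by
    have hpos : ∀ i, (hM F).eigenvalues i ≠ 0 := fun i => (hc.trans_le
      ((hM F).eigenvalues_mem_Icc (hq F) (fun x => quadratic_form_le F x) i).1).ne'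
    rw [← Real.log_prod fun i _ => hpos i, Nat.cast_natAbs, Int.cast_abs, Real.log_abs,
      ← realMat_det, (hM F).det_eq_prod_eigenvalues]
    rfl
  set R := ‖leftMul f‖
  set τ := (vnTrace (CFC.log (leftMul f))).re with hτ
  have hcont : ContinuousOn Real.log (Set.Icc c R) :=
    Real.continuousOn_log.mono fun x hx => (hc.trans_le hx.1).ne'
  rw [Metric.tendsto_nhds]
  intro η hη
  obtain ⟨p, hp⟩ := exists_polynomial_near_of_continuousOn c R Real.log hcont (η / 4)
    (by positivity)
  have h1 : |τ - (vnTrace (Polynomial.aeval (leftMul f) p)).re| ≤ η / 4 := by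
    rw [hτ, ← Complex.sub_re, ← vnTrace_sub]
    refine (abs_re_vnTrace_le _).trans ?_
    exact hsa.norm_log_sub_aeval_le hc (by positivity) hA fun x hx => (hp x hx).le
  filter_upwards [(Metric.tendsto_nhds.1 (tendsto_sum_eval_eigenvalues hM p)) (η / 4)
    (by positivity), eventually_nonempty_invarianceFilter] with F hF hne
  have hF0 : (0 : ℝ) < F.card := by exact_mod_cast hne.card_pos
  have h2 : |Real.log (compMat f F).det.natAbs / F.card
      - (∑ i, p.eval ((hM F).eigenvalues i)) / F.card| ≤ η / 4 := by
    rw [hlogdet, ← sub_div, ← Finset.sum_sub_distrib, abs_div, abs_of_pos hF0, div_le_iff₀ hF0]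
    refine (Finset.abs_sum_le_sum_abs _ _).trans ?_
    have : ∀ i ∈ Finset.univ, |Real.log ((hM F).eigenvalues i) - p.eval ((hM F).eigenvalues i)|
        ≤ η / 4 := fun i _ => by
      rw [abs_sub_comm]
      exact (hp _ ((hM F).eigenvalues_mem_Icc (hq F) (fun x => quadratic_form_le F x) i)).le
    refine (Finset.sum_le_card_nsmul _ _ _ this).trans ?_
    rw [Finset.card_univ, Fintype.card_coe, nsmul_eq_mul, mul_comm]
  rw [Real.dist_eq] at hF ⊢
  rw [abs_lt] at *
  rw [abs_le] at *
  constructor <;> linarith [h1.1, h1.2, h2.1, h2.2, hF.1, hF.2]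

theorem log_fkDet (hsa : IsSelfAdjoint (leftMul f)) {c : ℝ} (hc : 0 < c)
    (hA : ∀ x : EllTwo Γ, c * ‖x‖ ^ 2 ≤ (inner ℂ x (leftMul f x)).re) :
    Real.log (fkDet (toVN f)) = (vnTrace (CFC.log (leftMul f))).re := by
  have h1 : ((star (toVN f) * toVN f : groupVN Γ) : EllTwo Γ →L[ℂ] EllTwo Γ) = leftMul f ^ 2 := by
    have : star (leftMul f) * leftMul f = leftMul f ^ 2 := by rw [hsa.star_eq, sq]
    exact this
  rw [fkDet, Real.log_exp, h1, hsa.log_sq hc hA]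
  have : ∀ T : EllTwo Γ →L[ℂ] EllTwo Γ, vnTrace (T + T) = vnTrace T + vnTrace T :=
    fun T => inner_add_right _ _ _
  rw [this, Complex.add_re]
  ring

end Trace

theorem ereal_log_natCast_div (n m : ℕ) (hn : n ≠ 0) :
    ENNReal.log (((n : ℕ∞) : ℝ≥0∞)) / (m : EReal) = ((Real.log n / m : ℝ) : EReal) := by
  have h : (((n : ℕ∞) : ℝ≥0∞)) = (n : ℝ≥0∞) := rfl
  rw [h, ENNReal.log_pos_real (by exact_mod_cast hn) (ENNReal.natCast_ne_top n),
    ENNReal.toReal_natCast, EReal.coe_div]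
  rfl

/-! ### Open covers, separated sets and topological entropy. -/

section Entropy

variable {Γ : Type*} [Group Γ] {f : MonoidAlgebra ℤ Γ}

instance compactSpace_algX : CompactSpace (algX f) := by
  refine isCompact_iff_compactSpace.1 (IsClosed.isCompact ?_)
  have : algX f = ⋂ t : Γ, {h : Γ → UnitAddCircle |
      ∑ s ∈ f.coeff.support, f.coeff s • h (s⁻¹ * t) = 0} := by
    ext h; simp [algX]
  rw [this]
  exact isClosed_iInter fun t => isClosed_eq (by fun_prop) continuous_const

/-- The uniformity of a product only constrains finitely many coordinates; `K` collects them. -/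
theorem exists_lebesgue_number {U : Set (Set (algX f))} (hU : ∀ V ∈ U, IsOpen V)
    (hcov : ⋃₀ U = Set.univ) {ε : ℝ} (hε : 0 < ε) :
    ∃ K : Finset Γ, 1 ∈ K ∧ ∃ δ, 0 < δ ∧ δ ≤ ε ∧ ∀ x : algX f, ∃ V ∈ U, ∀ y : algX f,
      (∀ t ∈ K, dist (y.1 t) (x.1 t) ≤ δ) → y ∈ V := by
  obtain ⟨V, hV, hVU⟩ := lebesgue_number_lemma (ι := U) (U := fun V => V.1) isCompact_univ
    (fun V => hU V.1 V.2) (by rw [← Set.sUnion_eq_iUnion, hcov])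
  rw [uniformity_subtype, mem_comap] at hV
  obtain ⟨W, hW, hWV⟩ := hV
  rw [Pi.uniformity, mem_iInf] at hW
  obtain ⟨I, hI, V', hV', rfl⟩ := hW
  have hδi : ∀ i : I, ∃ δ > 0, ∀ a : (Γ → UnitAddCircle) × (Γ → UnitAddCircle),
      dist (a.1 i) (a.2 i) < δ → a ∈ V' i := fun i => by
    obtain ⟨T, hT, hTV⟩ := mem_comap.1 (hV' i)
    obtain ⟨δ, hδ, h⟩ := Metric.mem_uniformity_dist.1 hT
    exact ⟨δ, hδ, fun a ha => hTV (h ha)⟩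
  choose d hd hdV using hδi
  have : Finite I := hI
  obtain ⟨δ, hδ, hδd⟩ : ∃ δ > 0, ∀ i, δ < d i :=
    ((eventually_mem_nhdsWithin (a := (0 : ℝ)) (s := Set.Ioi 0)).and (eventually_all.2 fun i =>
      (nhdsWithin_le_nhds (gt_mem_nhds (hd i))))).exists
  -- The identity is added so that `F ⊆ KF`, and `δ` is capped so that the limit for small scales
  -- applies to it.
  refine ⟨insert 1 hI.toFinset, Finset.mem_insert_self _ _, min δ ε, lt_min hδ hε,
    min_le_right _ _, fun x => ?_⟩
  obtain ⟨i, hi⟩ := hVU x (Set.mem_univ x)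
  refine ⟨i.1, i.2, fun y hy => hi (hWV ?_)⟩
  rw [Set.mem_preimage, Set.mem_iInter]
  intro j
  refine hdV j _ ?_
  rw [dist_comm]
  exact (hy j (Finset.mem_insert_of_mem (hI.mem_toFinset.2 j.2))).trans_lt
    ((min_le_left _ _).trans_lt (hδd j))

/-- Each point of a maximal separated set selects one member of the join. Coordinate `t` of `γ x` is
coordinate `tγ` of `x`, so closeness on `KF` puts nearby points into that member. -/
theorem coverNumber_le_sepNumber {U : Set (Set (algX f))} {K F : Finset Γ} {δ : ℝ} (hδ : 0 ≤ δ)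
    (h : ∀ x : algX f, ∃ V ∈ U, ∀ y : algX f, (∀ t ∈ K, dist (y.1 t) (x.1 t) ≤ δ) → y ∈ V) :
    coverNumber (coverJoin (algAction f) U F)
      ≤ sepNumber (algAction f) (algPseudoDist f) (K * F) δ := by
  obtain ⟨E, -, hE, hmax⟩ := exists_maximal_sep (f := f) (F := K * F) hδ Set.univ
  choose V hV hVy using h
  set B : algX f → Set (algX f) := fun x =>
    ⋂ γ ∈ F, (algAction f γ) ⁻¹' (V (algAction f γ x)) with hB
  refine (iInf₂_le (B '' E) ⟨?_, ?_⟩).trans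
    ((Set.encard_image_le B E).trans (encard_le_sepNumber hE))
  · rintro _ ⟨x, -, rfl⟩
    exact ⟨fun γ => V (algAction f γ x), fun γ _ => hV _, rfl⟩
  · refine Set.eq_univ_of_forall fun y => ?_
    obtain ⟨x, hx, hxy⟩ := hmax y (Set.mem_univ y)
    refine ⟨B x, ⟨x, hx, rfl⟩, Set.mem_iInter₂.2 fun γ hγ => hVy _ _ fun t ht => ?_⟩
    exact hxy (t * γ) (Finset.mul_mem_mul ht hγ)

/-- Points sharing a member of the join are `ε`-close on `F`, so a separated set injects into every
subcover. -/
theorem sepNumber_le_coverNumber {U : Set (Set (algX f))} {F : Finset Γ} {ε : ℝ} (hε : 0 ≤ ε)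
    (h : ∀ V ∈ U, ∀ x ∈ V, ∀ y ∈ V, dist (x.1 1) (y.1 1) ≤ ε) :
    sepNumber (algAction f) (algPseudoDist f) F ε
      ≤ coverNumber (coverJoin (algAction f) U F) := by
  refine iSup₂_le fun E hE => le_iInf₂ fun W hW => ?_
  have hcov : ∀ x : algX f, ∃ V ∈ W, x ∈ V := fun x => by
    have : x ∈ ⋃₀ W := hW.2 ▸ Set.mem_univ x
    exact this
  choose V hVW hxV using hcov
  refine Set.encard_le_encard_of_injOn (f := V) (fun x _ => hVW x) fun x hx y hy hxy => ?_
  by_contra hne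
  refine absurd (hE x hx y hy hne) (not_lt.2 ((orbitDist_le_iff hε x y).2 fun t ht => ?_))
  obtain ⟨u, huU, hu⟩ := hW.1 (hVW x)
  have h1 := hxV x
  have h2 := hxV y
  rw [← hxy] at h2
  rw [hu] at h1 h2
  have := h (u t) (huU t ht) _ (Set.mem_iInter₂.1 h1 t ht) _ (Set.mem_iInter₂.1 h2 t ht)
  change dist (x.1 (1 * t)) (y.1 (1 * t)) ≤ ε at this
  rwa [one_mul] at this

theorem exists_small_cover {ε : ℝ} (hε : 0 < ε) :
    ∃ U : Set (Set (algX f)), (U.Finite ∧ (∀ V ∈ U, IsOpen V) ∧ ⋃₀ U = Set.univ) ∧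
      ∀ V ∈ U, ∀ x ∈ V, ∀ y ∈ V, dist (x.1 1) (y.1 1) ≤ ε := by
  obtain ⟨T, -, hT, hcov⟩ := (isCompact_univ (X := UnitAddCircle)).finite_cover_balls
    (half_pos hε)
  refine ⟨(fun c => {x : algX f | x.1 1 ∈ Metric.ball c (ε / 2)}) '' T,
    ⟨hT.image _, ?_, ?_⟩, ?_⟩
  · rintro _ ⟨c, -, rfl⟩
    exact Metric.isOpen_ball.preimage ((continuous_apply 1).comp continuous_subtype_val)
  · refine Set.eq_univ_of_forall fun x => ?_
    obtain ⟨c, hc, hxc⟩ := Set.mem_iUnion₂.1 (hcov (Set.mem_univ (x.1 1)))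
    exact ⟨_, ⟨c, hc, rfl⟩, hxc⟩
  · rintro _ ⟨c, -, rfl⟩ x hx y hy
    have h1 : dist (x.1 1) c < ε / 2 := hx
    have h2 : dist (y.1 1) c < ε / 2 := hy
    have := dist_triangle_right (x.1 1) (y.1 1) c
    linarith

theorem one_le_sepNumber (F : Finset Γ) (ε : ℝ) :
    1 ≤ sepNumber (algAction f) (algPseudoDist f) F ε := by
  have h0 : (fun _ => 0 : Γ → UnitAddCircle) ∈ algX f := fun t => by simp
  have hs : IsSep F ε ({⟨_, h0⟩} : Set (algX f)) := by
    rintro x rfl y rfl hxy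
    exact absurd rfl hxy
  simpa using encard_le_sepNumber hs

theorem exists_sepNumber_eq {c : ℝ} (hc : 0 < c)
    (hq : ∀ (F : Finset Γ) (x : F → ℝ),
      c * ∑ t, x t ^ 2 ≤ ∑ t, x t * (realMat f F).mulVec x t)
    {ε : ℝ} (hε : 0 < ε) (F : Finset Γ) :
    ∃ N : ℕ, N ≠ 0 ∧ sepNumber (algAction f) (algPseudoDist f) F ε = N ∧
      N ≤ (compMat f F).det.natAbs *
        (latticeBall F (4 * (ε ^ 2)⁻¹ * (c ^ 2)⁻¹ * (bdry f F).card)).ncard := by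
  have hle : sepNumber (algAction f) (algPseudoDist f) F ε ≤ _ :=
    iSup₂_le fun E hE => encard_le_of_isSep hc hε (hq F) hE
  obtain ⟨N, hN⟩ := ENat.ne_top_iff_exists.1 (ne_top_of_le_ne_top (ENat.natCast_ne_top _) hle)
  have h1 := one_le_sepNumber (f := f) F ε
  rw [← hN] at hle h1
  refine ⟨N, ?_, hN.symm, by exact_mod_cast hle⟩
  have : 1 ≤ N := by exact_mod_cast h1
  omega

theorem tendsto_log_sepNumber {c C τ ε : ℝ} (hc : 0 < c) (hC : 0 ≤ C)
    (hq : ∀ (F : Finset Γ) (x : F → ℝ),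
      c * ∑ t, x t ^ 2 ≤ ∑ t, x t * (realMat f F).mulVec x t)
    (hsol : ∀ (F : Finset Γ) (w : F → ℝ), ∃ v : Γ → ℝ,
      (∀ t, conv f v t = if h : t ∈ F then w ⟨t, h⟩ else 0) ∧
      ∑ t : F, v t ^ 2 ≤ C * ∑ t : F, w t ^ 2)
    (hD : Tendsto (fun F => Real.log (compMat f F).det.natAbs / F.card) (invarianceFilter Γ) (𝓝 τ))
    (hε : 0 < ε) (hL : 0 < l1Norm f) (hε' : ε ≤ 1 / (2 * l1Norm f)) :
    Tendsto (fun F => Real.log (sepNumber (algAction f) (algPseudoDist f) F ε).toNat / F.card)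
      (invarianceFilter Γ) (𝓝 τ) := by
  have hb : Tendsto (fun F => ((bdry f F).card : ℝ) / F.card) (invarianceFilter Γ) (𝓝 0) := by
    simp only [bdry_eq_outer]
    exact tendsto_card_outer_div _
  refine tendsto_of_growth_bounds (C₁ := 4 * (ε ^ 2)⁻¹ * (c ^ 2)⁻¹)
    (C₂ := 2 * l1Norm f + 16 * C * l1Norm f ^ 3) hD hb (fun s hs => ?_) fun s hs => ?_
  all_goals
    filter_upwards [eventually_nonempty_invarianceFilter] with F hF
    obtain ⟨N, hN0, hN, hle⟩ := exists_sepNumber_eq hc hq hε F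
    have hF0 : (0 : ℝ) < F.card := by exact_mod_cast hF.card_pos
    have hdet : (0 : ℝ) < (compMat f F).det.natAbs := by
      exact_mod_cast Int.natAbs_pos.2 (compMat_det_ne_zero hc (hq F))
    have hNpos : (0 : ℝ) < N := by exact_mod_cast Nat.pos_of_ne_zero hN0
    have hθ : 0 < latticeGrowth s := one_pos.trans_le (one_le_latticeGrowth hs)
    rw [hN, ENat.toNat_natCast]
  · have h1 : (N : ℝ) ≤ (compMat f F).det.natAbs *
        (Real.exp (s * (4 * (ε ^ 2)⁻¹ * (c ^ 2)⁻¹ * (bdry f F).card)) *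
          latticeGrowth s ^ F.card) := by
      have h := ncard_latticeBall_le F (4 * (ε ^ 2)⁻¹ * (c ^ 2)⁻¹ * (bdry f F).card) hs
      rw [Fintype.card_coe] at h
      calc (N : ℝ) ≤ _ := by exact_mod_cast hle
        _ ≤ _ := mul_le_mul_of_nonneg_left h hdet.le
    have h2 := Real.log_le_log hNpos h1
    rw [Real.log_mul hdet.ne' (by positivity), Real.log_mul (by positivity) (by positivity),
      Real.log_exp, Real.log_pow] at h2
    rw [div_le_iff₀ hF0]
    field_simp
    field_simp at h2
    linarith
  · have h1 : ((compMat f F).det.natAbs : ℝ) ≤ N *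
        (Real.exp (s * ((2 * l1Norm f + 16 * C * l1Norm f ^ 3) * F.card)) *
          latticeGrowth s ^ (bdry f F).card) := by
      have h := ncard_latticeBall_le (bdry f F)
        ((2 * l1Norm f + 16 * C * l1Norm f ^ 3) * F.card) hs
      rw [Fintype.card_coe] at h
      have hle' := natAbs_det_le hc hε hL hε' hC (hq F) (hsol F) hN
      calc ((compMat f F).det.natAbs : ℝ) ≤ _ := by exact_mod_cast hle'
        _ ≤ _ := mul_le_mul_of_nonneg_left h hNpos.le
    have h2 := Real.log_le_log hdet h1
    rw [Real.log_mul hNpos.ne' (by positivity), Real.log_mul (by positivity) (by positivity),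
      Real.log_exp, Real.log_pow] at h2
    rw [div_le_iff₀ hF0]
    have h3 : (Real.log N / F.card + s * (2 * l1Norm f + 16 * C * l1Norm f ^ 3)
        + (bdry f F).card / F.card * Real.log (latticeGrowth s)) * F.card
        = Real.log N + s * ((2 * l1Norm f + 16 * C * l1Norm f ^ 3) * F.card)
          + (bdry f F).card * Real.log (latticeGrowth s) := by
      field_simp
    linarith

/-- Every cover is dominated by separated sets at some scale `δ ≤ ε₀`, and a cover that is fine at
`e` dominates scale `ε₀`. Both scales grow at rate `τ`. A nontrivial filter makes upper limits equal
to limits. -/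
theorem topEntropy_eq [(invarianceFilter Γ).NeBot] {τ ε₀ : ℝ} (hε₀ : 0 < ε₀)
    (hfin : ∀ ε, 0 < ε → ∀ F : Finset Γ, ∃ N : ℕ, N ≠ 0 ∧
      sepNumber (algAction f) (algPseudoDist f) F ε = N)
    (hlim : ∀ ε, 0 < ε → ε ≤ ε₀ → Tendsto (fun F =>
      Real.log (sepNumber (algAction f) (algPseudoDist f) F ε).toNat / F.card)
      (invarianceFilter Γ) (𝓝 τ)) :
    topEntropy (algAction f) = (τ : EReal) := by
  refine le_antisymm (iSup₂_le fun U hU => ?_) ?_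
  · obtain ⟨K, hK, δ, hδ, hδε, hV⟩ := exists_lebesgue_number hU.2.1 hU.2.2 hε₀
    have hlim' : Tendsto (fun F : Finset Γ => (((Real.log (sepNumber (algAction f)
        (algPseudoDist f) (K * F) δ).toNat / F.card : ℝ)) : EReal)) (invarianceFilter Γ)
        (𝓝 (τ : EReal)) := by
      refine (continuous_coe_real_ereal.tendsto τ).comp ?_
      -- Separation is measured on `KF` but normalised by `|F|`; the ratio `|KF|/|F|` tends to 1.
      have h := ((hlim δ hδ hδε).comp (tendsto_mul_invarianceFilter hK)).mul
        (tendsto_card_mul_div hK)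
      rw [mul_one] at h
      refine h.congr' ?_
      filter_upwards [eventually_nonempty_invarianceFilter] with F hF
      have : ((K * F).card : ℝ) ≠ 0 := by
        have : (K * F).Nonempty := Finset.Nonempty.mul ⟨1, hK⟩ hF
        exact_mod_cast this.card_pos.ne'
      simp only [Function.comp_apply]
      field_simp
    rw [← hlim'.limsup_eq]
    refine limsup_le_limsup (Eventually.of_forall fun F => ?_)
    obtain ⟨N, hN0, hN⟩ := hfin δ hδ (K * F)
    have hle := coverNumber_le_sepNumber (F := F) hδ.le hV
    simp only
    rw [hN] at hle ⊢
    rw [ENat.toNat_natCast, ← ereal_log_natCast_div N F.card hN0]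
    refine EReal.div_le_div_right_of_nonneg (by positivity) (ENNReal.log_le_log ?_)
    exact_mod_cast hle
  · obtain ⟨U, hU, hUε⟩ := exists_small_cover (f := f) hε₀
    refine le_trans ?_ (le_iSup₂ (f := fun (U : Set (Set (algX f)))
      (_ : U.Finite ∧ (∀ V ∈ U, IsOpen V) ∧ ⋃₀ U = Set.univ) => coverEntropy (algAction f) U) U hU)
    have hlim' := (continuous_coe_real_ereal.tendsto τ).comp (hlim ε₀ hε₀ le_rfl)
    rw [← hlim'.limsup_eq]
    refine limsup_le_limsup (Eventually.of_forall fun F => ?_)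
    obtain ⟨N, hN0, hN⟩ := hfin ε₀ hε₀ F
    have hle := sepNumber_le_coverNumber (F := F) hε₀.le hUε
    simp only [Function.comp_apply]
    rw [hN] at hle ⊢
    rw [ENat.toNat_natCast, ← ereal_log_natCast_div N F.card hN0]
    refine EReal.div_le_div_right_of_nonneg (by positivity) (ENNReal.log_le_log ?_)
    exact_mod_cast hle

end Entropy
end

/-! ### Transfer to the Følner net. -/

theorem theorem5p4 {Γ : Type*} [Group Γ] [Infinite Γ] (f : MonoidAlgebra ℤ Γ)
    (hpos : ∃ b : groupVN Γ, toVN f = star b * b) (hinv : IsUnit (toVN f))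
    {J : Type*} [Preorder J] [IsDirectedOrder J] [Nonempty J] (F : J → Finset Γ)
    (hF : IsFolnerNet F) (ε : ℝ) (hε : 0 < ε) (hε' : ε ≤ 1 / (2 * l1Norm f)) :
    Tendsto (fun n => ENNReal.log
        (sepNumber (algAction f) (algPseudoDist f) (F n) ε : ℝ≥0∞) / ((F n).card : EReal))
      atTop (𝓝 (topEntropy (algAction f))) ∧
    Tendsto (fun n => ENNReal.log (cokerCard f (F n) : ℝ≥0∞) / ((F n).card : EReal))
      atTop (𝓝 (topEntropy (algAction f))) ∧
    Tendsto (fun n => ENNReal.log ‖compressionDet f (F n)‖ₑ / ((F n).card : EReal))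
      atTop (𝓝 (topEntropy (algAction f))) ∧
    topEntropy (algAction f) = ((Real.log (fkDet (toVN f)) : ℝ) : EReal) := by
  have hFt := hF.tendsto_invarianceFilter
  have hne : (invarianceFilter Γ).NeBot := NeBot.mono inferInstance hFt
  have hsa := isSelfAdjoint_leftMul hpos
  obtain ⟨c, hc, hq, hA⟩ := exists_quadratic_form_bounds hpos hinv
  obtain ⟨C, hC, hsol⟩ := exists_real_solution hinv
  -- Were `‖f‖₁` not positive, `1 / (2‖f‖₁)` would be at most 0 (division by zero gives 0),
  -- contradicting `0 < ε`.
  have hL : 0 < l1Norm f := by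
    by_contra h
    have h2 : 1 / (2 * l1Norm f) ≤ 0 := div_nonpos_of_nonneg_of_nonpos one_pos.le (by linarith)
    linarith
  have hD := tendsto_log_det hc hsa (isHermitian_realMat hpos) hq hA
  rw [← log_fkDet hsa hc hA] at hD
  have hsep := fun δ hδ hδ' => tendsto_log_sepNumber (ε := δ) hc hC hq hsol hD hδ hL hδ'
  have hfin : ∀ ε, 0 < ε → ∀ F : Finset Γ, ∃ N : ℕ, N ≠ 0 ∧
      sepNumber (algAction f) (algPseudoDist f) F ε = N := fun ε hε F => by
    obtain ⟨N, h1, h2, -⟩ := exists_sepNumber_eq hc hq hε F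
    exact ⟨N, h1, h2⟩
  have hent := topEntropy_eq hε hfin fun δ hδ hδ' => hsep δ hδ (hδ'.trans hε')
  have hdet := fun n => compMat_det_ne_zero hc (hq (F n))
  have hcoker : Tendsto (fun n => ENNReal.log (cokerCard f (F n) : ℝ≥0∞) / ((F n).card : EReal))
      atTop (𝓝 (topEntropy (algAction f))) := by
    rw [hent]
    refine ((continuous_coe_real_ereal.tendsto _).comp (hD.comp hFt)).congr fun n => ?_
    rw [(cokerCard_eq f (F n) (hdet n)).1,
      ereal_log_natCast_div _ _ (Int.natAbs_ne_zero.2 (hdet n))]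
    rfl
  refine ⟨?_, hcoker, ?_, hent⟩
  · rw [hent]
    refine ((continuous_coe_real_ereal.tendsto _).comp ((hsep ε hε hε').comp hFt)).congr
      fun n => ?_
    obtain ⟨N, hN0, hN⟩ := hfin ε hε (F n)
    simp only [Function.comp_apply]
    rw [hN, ENat.toNat_natCast, ereal_log_natCast_div N _ hN0]
  · refine hcoker.congr fun n => ?_
    rw [(cokerCard_eq f (F n) (hdet n)).1, compressionDet_eq]
    congr 2
    rw [← ofReal_norm, Complex.norm_intCast, ← Int.cast_abs, Int.abs_eq_natAbs, Int.cast_natCast,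
      ENNReal.ofReal_natCast]
    rfl
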